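/- Let $p$ be an odd prime, $K=\mathbb{Q}(\zeta)$ the $p$-th cyclotomic field ($\zeta$ a primitive $p$-th root of unity), $O_K$ its ring of integers and $\pi=(1-\zeta)O_K$ the prime ideal above $p$. Let $x\mapsto\overline{x}$ denote complex conjugation. Let $u\in\mathbb{N}$ be a primitive root mod $p$, let $\sigma\in\mathrm{Gal}(K/\mathbb{Q})$ be given by $\sigma(\zeta)=\zeta^u$, and for $i\ge 0$ let $u_i$ be the integer with $u_i\equiv u^i \pmod p$, $1\le u_i\le p-1$. Congruences mod $\pi^k$ in $K$ are taken in the localization of $O_K$ at $\pi$, and $\pi^k\,\|\,x$ means $v_\pi(x)=k$. A number $C\in K$ is called *singular* if $C$ is not a $p$-th power in $K$ and $CO_K=\mathbf{c}^p$ for some fractional ideal $\mathbf{c}$ of $K$. A singular $C$ is *semi-primary* if $C\equiv c \bmod \pi^2$ for some $c\in\mathbb{Z}$ with $p\nmid c$. It is *primary* if $C\equiv c^p\bmod \pi^p$ for some $c\in\mathbb{Z}$ with $p\nmid c$, and *non-primary* otherwise. Let $C_p$ be the group of ideal classes of $K$ killed by $p$, and $C_p^-$ its minus part, i.e. the subgroup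 of classes inverted by complex conjugation. Let $\mu\in\mathbf{F}_p^*$ and let $\mathbf{b}$ be a nonzero ideal of $O_K$ whose class $Cl(\mathbf{b})$ is nontrivial, lies in $C_p^-$, and is annihilated by $\sigma-\mu$, i.e. $\sigma(Cl(\mathbf{b}))=Cl(\mathbf{b})^{\mu}$. Let $B\in O_K$ be a singular semi-primary integer with $BO_K=\mathbf{b}^p$, and put $C=B/\overline{B}$. Then $C$ is singular, and there is a natural number $m$ with $1\le m\le \frac{p-3}{2}$ such that $\mu=u_{2m+1}$ in $\mathbf{F}_p$ and, if $C$ is non-primary, then $\pi^{2m+1}\,\|\,C-1$. -/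

import Mathlib

open NumberField nonZeroDivisors

namespace CycSing

section General

variable {K : Type*} [Field K] [NumberField K]

/-- Congruence `x ≡ y mod P ^ k` between elements of `K` in the localization of `𝓞 K` at the
prime `P`: the difference `x - y` is a fraction `a / s` with `a ∈ P ^ k` and `s ∉ P`. -/
def CongMod (P : Ideal (𝓞 K)) (k : ℕ) (x y : K) : Prop :=
  ∃ a ∈ P ^ k, ∃ s : 𝓞 K, s ∉ P ∧ (s : K) * (x - y) = (a : K)

/-- `P ^ k ‖ x`: `x` has valuation exactly `k` at the prime `P`. -/
def ExactlyDivides (P : Ideal (𝓞 K)) (k : ℕ) (x : K) : Prop :=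
  CongMod P k x 0 ∧ ¬ CongMod P (k + 1) x 0

/-- `C ∈ K` is singular: it is not a `p`-th power in `K`, and the fractional ideal `C 𝓞 K` is the
`p`-th power of a fractional ideal. -/
def IsSingular (p : ℕ) (C : K) : Prop :=
  (¬ ∃ x : K, x ^ p = C) ∧
    ∃ c : FractionalIdeal (𝓞 K)⁰ K, FractionalIdeal.spanSingleton (𝓞 K)⁰ C = c ^ p

/-- `C ≡ c mod P ^ 2` for a rational integer `c` prime to `p`. -/
def IsSemiPrimary (p : ℕ) (P : Ideal (𝓞 K)) (C : K) : Prop :=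
  ∃ c : ℤ, ¬ (p : ℤ) ∣ c ∧ CongMod P 2 C (c : K)

/-- `C` is singular primary: it is singular and `C ≡ c ^ p mod P ^ p` for a rational integer `c`
prime to `p`. -/
def IsSingularPrimary (p : ℕ) (P : Ideal (𝓞 K)) (C : K) : Prop :=
  IsSingular p C ∧ ∃ c : ℤ, ¬ (p : ℤ) ∣ c ∧ CongMod P p C ((c : K) ^ p)

/-- The action of a field automorphism on the ideal class group: `Cl(I) ↦ Cl(τ(I))`. -/
noncomputable def galClass (τ : K ≃ₐ[ℚ] K) : ClassGroup (𝓞 K) ≃* ClassGroup (𝓞 K) :=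
  ClassGroup.mulEquiv (RingOfIntegers.mapRingEquiv τ.toRingEquiv)

/-- On the class of an ideal, `galClass` is given by the image of the ideal. -/
theorem galClass_mk0 (τ : K ≃ₐ[ℚ] K) (I J : (Ideal (𝓞 K))⁰)
    (h : (J : Ideal (𝓞 K)) =
      (I : Ideal (𝓞 K)).map (RingOfIntegers.mapRingEquiv τ.toRingEquiv)) :
    galClass τ (ClassGroup.mk0 I) = ClassGroup.mk0 J := by
  unfold galClass
  rw [ClassGroup.mulEquiv_apply]
  simp only [ClassGroup.equiv_mk0]
  rw [MulEquiv.symm_apply_eq]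
  simp only [ClassGroup.equiv_mk0]
  refine congrArg (QuotientGroup.mk' _) ?_
  ext1
  apply FractionalIdeal.coeToSubmodule_injective
  ext x
  change x ∈ Submodule.map _ (FractionalIdeal.mk0 (FractionRing (𝓞 K)) I).val.val ↔ _
  simp only [Submodule.mem_map, FractionalIdeal.coe_mk0, FractionalIdeal.val_eq_coe, FractionalIdeal.mem_coe, FractionalIdeal.mem_coeIdeal, h]
  constructor
  · rintro ⟨_, ⟨y, hy, rfl⟩, rfl⟩
    exact ⟨_, Ideal.mem_map_of_mem _ hy, (IsFractionRing.ringEquivOfRingEquiv_algebraMap (K := FractionRing (𝓞 K)) (L := FractionRing (𝓞 K)) _ y).symm⟩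
  · rintro ⟨y, hy, rfl⟩
    obtain ⟨z, hz, rfl⟩ := (Ideal.mem_map_of_equiv _ _).1 hy
    exact ⟨_, ⟨z, hz, rfl⟩, (IsFractionRing.ringEquivOfRingEquiv_algebraMap (K := FractionRing (𝓞 K)) (L := FractionRing (𝓞 K)) _ z)⟩

end General

section Cyclotomic

variable (p : ℕ) [Fact p.Prime] (K : Type*) [Field K] [NumberField K]
  [IsCyclotomicExtension {p} ℚ K]

/-- Complex conjugation of the `p`-th cyclotomic field: the automorphism corresponding to
`-1 ∈ (ℤ/p)ˣ`. -/
noncomputable def conj : K ≃ₐ[ℚ] K :=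
  (IsCyclotomicExtension.autEquivPow K
    (Polynomial.cyclotomic.irreducible_rat (Fact.out : p.Prime).pos)).symm (-1)

/-- Complex conjugation inverts every `p`-th root of unity. -/
theorem conj_apply (ζ : K) (hζ : ζ ^ p = 1) : conj p K ζ = ζ⁻¹ := by
  have hz := IsCyclotomicExtension.zeta_spec p ℚ K
  set z := IsCyclotomicExtension.zeta p ℚ K with hzdef
  have h1 : conj p K z = z⁻¹ := by
    have h := hz.autToPow_spec ℚ (conj p K)
    have h2 : hz.autToPow ℚ (conj p K) = -1 :=
      (IsCyclotomicExtension.autEquivPow K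
        (Polynomial.cyclotomic.irreducible_rat (Fact.out : p.Prime).pos)).apply_symm_apply (-1)
    rw [h2] at h
    rw [← h]
    refine eq_inv_of_mul_eq_one_left ?_
    rw [← pow_succ, hz.pow_eq_one_iff_dvd, ← ZMod.natCast_eq_zero_iff]
    simp
  obtain ⟨i, -, rfl⟩ := hz.eq_pow_of_pow_eq_one hζ
  rw [map_pow, h1, inv_pow]

/-- The minus part `C_p⁻` of the group `C_p` of the ideal classes `c` with `c ^ p = 1`: complex
conjugation inverts `c`. -/
def minusPart : Subgroup (ClassGroup (𝓞 K)) where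
  carrier := {c | c ^ p = 1 ∧ galClass (conj p K) c = c⁻¹}
  one_mem' := by simp
  mul_mem' := by
    rintro a b ⟨ha, ha'⟩ ⟨hb, hb'⟩
    exact ⟨by rw [mul_pow, ha, hb, one_mul], by rw [map_mul, ha', hb', mul_inv]⟩
  inv_mem' := by
    rintro a ⟨ha, ha'⟩
    exact ⟨by rw [inv_pow, ha, inv_one], by rw [map_inv, ha']⟩

end Cyclotomic

/-- `u_i`: the least non-negative residue of `u ^ i` modulo `p`. -/
def powRes (p u i : ℕ) : ℕ := u ^ i % p

/-- The prime ideal `π = (ζ - 1) 𝓞 K` above `p`. -/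
noncomputable def primeAbove {p : ℕ} [NeZero p] {K : Type*} [Field K] {ζ : K}
    (hζ : IsPrimitiveRoot ζ p) : Ideal (𝓞 K) :=
  Ideal.span {hζ.toInteger - 1}

end CycSing

/-! Put `C = B / conj B` and let `n` represent `μ`. If `C` were a `p`-th power, `Cl(b)` would be
fixed as well as inverted by conjugation, hence killed by both `2` and `p`, hence trivial. So `C` is
singular.

The relation `σ Cl(b) = Cl(b) ^ n` gives `σ B = η * B ^ n * z ^ p` with `η` a unit. Dividing by the
conjugate relation replaces `η` by `η / conj η`, a root of unity by Kronecker, so `σ C = ζ ^ r * C ^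
n * y ^ p`. Since `C ≡ 1 mod π ^ 2`, comparison modulo `π ^ 2` kills `ζ ^ r` and gives `y ^ p ≡ 1
mod π ^ p` (`map_eq_pow_mul_pow`). As `σ` acts on `π ^ k / π ^ (k + 1)` as `u ^ k` and `C ↦ C ^ n`
multiplies `C - 1` by `n` to first order, `π ^ k ‖ C - 1` with `k < p` forces `u ^ k = μ`
(`exists_exact`).

Conjugation is `σ ^ ((p - 1) / 2)` and inverts `Cl(b)`, so `μ = u ^ e` with `e` odd. In the case `π
^ k ‖ C - 1` with `k < p`, `k = e ≥ 2`. If instead `C ≡ 1 mod π ^ p`, only `e = 1` must be excluded.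
There Kummer's reflection applies: `K(C ^ (1 / p)) / K` is unramified, yet `μ = u` makes this field
abelian over `ℚ`, so it contains a field of degree `p` over `ℚ`. By Minkowski some prime ramifies
there with index `p`, while all ramification indices of the big field divide `p - 1`. -/

/-! ### Unramified Kummer extensions -/

open Polynomial in
/-- A prime `Q` of `𝓞 L` is unramified over `𝓞 K` as soon as some generator `β` of `L / K` is a
root of a polynomial whose derivative at `β` is not in `Q`. -/
theorem isUnramifiedAt_of_aeval_derivative_notMem {K L : Type*} [Field K] [NumberField K] [Field L]
    [NumberField L] [Algebra K L] (Q : Ideal (𝓞 L)) [Q.IsPrime] (β : 𝓞 L)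
    (hβ : Algebra.adjoin K {(β : L)} = ⊤) (g : (𝓞 K)[X]) (hg : aeval β g = 0)
    (hg' : aeval β (derivative g) ∉ Q) : Algebra.IsUnramifiedAt (𝓞 K) Q := by
  rw [← not_dvd_differentIdeal_iff, Ideal.dvd_iff_le]
  intro hle
  have hint : IsIntegral (𝓞 K) β := Algebra.IsIntegral.isIntegral β
  have hmem := hle (aeval_derivative_mem_differentIdeal (𝓞 K) K L β hβ)
  -- Writing `g = minpoly * h`, the product rule makes `g'(β)` a multiple of `minpoly'(β)`, which
  -- lies in the different.
  obtain ⟨h, rfl⟩ := minpoly.isIntegrallyClosed_dvd hint hg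
  apply hg'
  rw [derivative_mul, map_add, map_mul, map_mul, minpoly.aeval, zero_mul, add_zero]
  exact Q.mul_mem_right _ hmem

-- The derivative of `X ^ p - y` at `β` is `p * β ^ (p - 1)`. This handles the primes not above `p`.
open Polynomial in
theorem isUnramifiedAt_of_pow_eq {p : ℕ} {K L : Type*} [Field K] [NumberField K]
    [Field L] [NumberField L] [Algebra K L] (Q : Ideal (𝓞 L)) [Q.IsPrime] (β : L)
    (hβ : Algebra.adjoin K {β} = ⊤) (hp0 : p ≠ 0) (y : 𝓞 K) (hy : β ^ p = algebraMap K L y)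
    (hyQ : algebraMap (𝓞 K) (𝓞 L) y ∉ Q) (hpQ : (p : 𝓞 L) ∉ Q) :
    Algebra.IsUnramifiedAt (𝓞 K) Q := by
  have hint : IsIntegral ℤ β := by
    refine IsIntegral.of_pow (Nat.pos_of_ne_zero hp0) ?_
    rw [hy]
    exact (RingOfIntegers.isIntegral_coe y).map (algebraMap K L).toIntAlgHom
  let β' : 𝓞 L := ⟨β, hint⟩
  have hβ' : β' ^ p = algebraMap (𝓞 K) (𝓞 L) y := by
    apply FaithfulSMul.algebraMap_injective (𝓞 L) L
    rw [map_pow]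
    exact hy
  refine isUnramifiedAt_of_aeval_derivative_notMem Q β' hβ (X ^ p - C y) (by simp [hβ']) ?_
  simp only [derivative_sub, derivative_X_pow, derivative_C, sub_zero, map_mul, map_pow, aeval_X,
    map_natCast]
  intro h
  rcases Ideal.IsPrime.mem_or_mem ‹_› h with h | h
  · exact hpQ h
  · apply hyQ
    rw [← hβ', ← Nat.sub_add_cancel (Nat.pos_of_ne_zero hp0), pow_succ]
    exact Q.mul_mem_right _ h

/-- If the principal ideal `(c)` is the `p`-th power of an ideal, then up to `p`-th powers `c⁻¹` is
a unit at any given prime. -/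
theorem exists_pow_eq_mul_notMem {A : Type*} [CommRing A] [IsDedekindDomain A] {p : ℕ}
    (c : A) (hc : c ≠ 0) (a : Ideal A)
    (ha : Ideal.span {c} = a ^ p) (q : Ideal A) [q.IsPrime] (hp : p ≠ 0) :
    ∃ x y : A, x ≠ 0 ∧ x ^ p = c * y ∧ y ∉ q := by
  have ha0 : a ≠ 0 := by
    rintro rfl
    rw [zero_pow hp, Ideal.zero_eq_bot, Ideal.span_singleton_eq_bot] at ha
    exact hc ha
  -- An element `x` of `a` outside `a * q` has the same valuation at `q` as `a`, so `x ^ p / c` is a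
  -- unit at `q`.
  have hne : ¬ a ≤ a * q := by
    intro h
    have h2 : a * q = a * 1 := by rw [mul_one]; exact le_antisymm Ideal.mul_le_left h
    have h3 : q = 1 := mul_left_cancel₀ ha0 h2
    exact Ideal.IsPrime.ne_top ‹q.IsPrime› (h3.trans Ideal.one_eq_top)
  obtain ⟨x, hxa, hxq⟩ := SetLike.not_le_iff_exists.mp hne
  obtain ⟨I, hI⟩ := Ideal.dvd_span_singleton.mpr hxa
  have hx0 : x ≠ 0 := by
    rintro rfl
    exact hxq (zero_mem _)
  have hIq : ¬ I ≤ q := fun h => hxq (by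
    have : x ∈ a * I := hI ▸ Ideal.mem_span_singleton_self x
    exact Ideal.mul_mono_right h this)
  have hxp : x ^ p ∈ Ideal.span {c} := by rw [ha]; exact Ideal.pow_mem_pow hxa p
  obtain ⟨y, hy⟩ := Ideal.mem_span_singleton.mp hxp
  refine ⟨x, y, hx0, hy, fun hyq => hIq ?_⟩
  have h1 : Ideal.span {c} * Ideal.span {y} = Ideal.span {c} * I ^ p := by
    rw [Ideal.span_singleton_mul_span_singleton, ← hy, ← Ideal.span_singleton_pow, hI, mul_pow, ha]
  have h2 : Ideal.span {y} = I ^ p :=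
    mul_left_cancel₀ (by rwa [Ne, Ideal.zero_eq_bot, Ideal.span_singleton_eq_bot]) h1
  refine Ideal.IsPrime.le_of_pow_le (n := p) ?_
  rw [← h2, Ideal.span_singleton_le_iff_mem]
  exact hyq

-- The congruence `c ≡ d ^ p mod l ^ p` makes `β = (α - d) / l` integral, and the equation of `β` is
-- separable modulo `Q`. This handles the primes above `p`.
open Polynomial in
theorem isUnramifiedAt_of_pow_sub_eq {p : ℕ} [Fact p.Prime] {K L : Type*} [Field K]
    [NumberField K] [Field L] [NumberField L] [Algebra K L] (Q : Ideal (𝓞 L)) [Q.IsPrime] (α : L)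
    (hα : Algebra.adjoin K {α} = ⊤) (c d e l w : 𝓞 K) (hc : α ^ p = algebraMap K L c)
    (hl : l ≠ 0) (hw : l ^ (p - 1) * w = p) (hwQ : algebraMap (𝓞 K) (𝓞 L) w ∉ Q)
    (hcd : c - d ^ p = l ^ p * e) (hcQ : algebraMap (𝓞 K) (𝓞 L) c ∉ Q) :
    Algebra.IsUnramifiedAt (𝓞 K) Q := by
  have hp : p.Prime := Fact.out
  have hp1 : p - 1 + 1 = p := Nat.sub_add_cancel hp.one_le
  obtain ⟨r, hr⟩ := exists_add_pow_prime_eq hp (C l * X) (C d : (𝓞 K)[X])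
  -- This is `((l X + d) ^ p - c) / l ^ p`; the mixed binomial terms are divisible by `p * l = l ^ p
  -- * w`.
  set g : (𝓞 K)[X] := X ^ p + C w * (C d * X * r) - C e with hgdef
  have hCp : ((p : ℕ) : (𝓞 K)[X]) = C l ^ (p - 1) * C w := by
    rw [← C_pow, ← C_mul, hw, map_natCast]
  have hg : C l ^ p * g = (C l * X + C d) ^ p - C c := by
    have h2 : C c = C d ^ p + C l ^ p * C e := by
      rw [← C_pow, ← C_pow, ← C_mul, ← C_add, ← hcd]; congr 1; ring
    have h3 : (C l : (𝓞 K)[X]) ^ p = C l ^ (p - 1) * C l := by rw [← pow_succ, hp1]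
    rw [hr, h2, hCp, hgdef, mul_pow]
    linear_combination (C w * (C d * X * r)) * h3
  have hlp : l ^ p ≠ 0 := pow_ne_zero _ hl
  have hdeg : ((C l * X + C d) ^ p : (𝓞 K)[X]).natDegree = p := by
    rw [natDegree_pow, natDegree_linear hl, mul_one]
  have hmonic : g.Monic := by
    have h1 := congrArg leadingCoeff hg
    have h2 : ((C l * X + C d) ^ p - C c : (𝓞 K)[X]).leadingCoeff = l ^ p := by
      rw [leadingCoeff_sub_of_degree_lt, leadingCoeff_pow, leadingCoeff_linear hl]
      refine lt_of_le_of_lt degree_C_le (natDegree_pos_iff_degree_pos.mp ?_)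
      rw [hdeg]; exact hp.pos
    rw [leadingCoeff_mul, ← C_pow, leadingCoeff_C, h2] at h1
    exact mul_left_cancel₀ hlp (h1.trans (mul_one _).symm)
  set lL : L := algebraMap K L l
  have hlL : lL ≠ 0 := by
    simpa [lL] using hl
  set β : L := (α - algebraMap K L d) / lL with hβdef
  have hαβ : α = lL * β + algebraMap K L d := by
    rw [hβdef, mul_div_cancel₀ _ hlL]; ring
  have hev : aeval β g = 0 := by
    have h1 := congrArg (aeval β) hg
    simp only [map_mul, map_pow, aeval_C, map_sub, map_add, aeval_X] at h1
    have hm : ∀ z : 𝓞 K, algebraMap (𝓞 K) L z = algebraMap K L z := fun z => rfl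
    rw [hm, hm, hm, ← hαβ, hc, sub_self] at h1
    exact (mul_eq_zero.mp h1).resolve_left (pow_ne_zero _ hlL)
  have hint : IsIntegral ℤ β :=
    isIntegral_trans (R := ℤ) (A := 𝓞 K) β ⟨g, hmonic, by rwa [← aeval_def]⟩
  let β' : 𝓞 L := ⟨β, hint⟩
  have hev' : aeval β' g = 0 := by
    apply FaithfulSMul.algebraMap_injective (𝓞 L) L
    rw [← aeval_algebraMap_apply, map_zero]
    exact hev
  have hadj : Algebra.adjoin K {(β' : L)} = ⊤ := by
    rw [eq_top_iff, ← hα]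
    refine Algebra.adjoin_le (Set.singleton_subset_iff.mpr ?_)
    have : (β' : L) = β := rfl
    rw [SetLike.mem_coe, hαβ, this]
    exact add_mem (mul_mem (Subalgebra.algebraMap_mem _ _) (Algebra.self_mem_adjoin_singleton K β))
      (Subalgebra.algebraMap_mem _ _)
  refine isUnramifiedAt_of_aeval_derivative_notMem Q β' hadj g hev' ?_
  set α' : 𝓞 L := algebraMap (𝓞 K) (𝓞 L) l * β' + algebraMap (𝓞 K) (𝓞 L) d with hα'
  have hα'c : α' ^ p = algebraMap (𝓞 K) (𝓞 L) c := by
    apply FaithfulSMul.algebraMap_injective (𝓞 L) L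
    rw [map_pow]
    have : algebraMap (𝓞 L) L α' = α := by
      rw [hαβ, hα']; rfl
    rw [this, hc]; rfl
  have hder : aeval β' (derivative g) = algebraMap (𝓞 K) (𝓞 L) w * α' ^ (p - 1) := by
    have h1 := congrArg (fun f => aeval β' (derivative f)) hg
    simp only [derivative_mul, derivative_C, derivative_pow,
      derivative_X, map_add, map_mul, map_pow, map_sub, aeval_C, aeval_X, map_natCast, zero_mul, mul_zero, zero_add, add_zero, sub_zero, mul_one,
      ← hα'] at h1
    rw [← map_natCast (algebraMap (𝓞 K) (𝓞 L)), ← hw, map_mul, map_pow] at h1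
    have h3 : (algebraMap (𝓞 K) (𝓞 L) l) ^ p = algebraMap (𝓞 K) (𝓞 L) l ^ (p - 1) *
      algebraMap (𝓞 K) (𝓞 L) l := by rw [← pow_succ, hp1]
    have h4 : (algebraMap (𝓞 K) (𝓞 L) l) ^ p ≠ 0 := by
      refine pow_ne_zero _ ?_
      simpa using hl
    refine mul_left_cancel₀ h4 (h1.trans ?_)
    rw [h3]; ring
  rw [hder]
  intro h
  rcases Ideal.IsPrime.mem_or_mem ‹_› h with h | h
  · exact hwQ h
  · apply hcQ
    rw [← hα'c, ← hp1, pow_succ]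
    exact Q.mul_mem_right _ h

/-- A Kummer extension generated by a `p`-th root of a singular primary number `c` is unramified at
all primes. Here `l` is a generator of the prime above `p`. -/
theorem isUnramifiedAt_of_isPrimary {p : ℕ} [Fact p.Prime] {K L : Type*} [Field K]
    [NumberField K] [Field L] [NumberField L] [Algebra K L] (Q : Ideal (𝓞 L)) [Q.IsPrime] (α : L)
    (hα : Algebra.adjoin K {α} = ⊤) (c d e l w : 𝓞 K) (hc : α ^ p = algebraMap K L c)
    (hl : l ≠ 0) (hw : l ^ (p - 1) * w = p) (hwu : IsUnit w) (hlmax : (Ideal.span {l}).IsMaximal)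
    (hcd : c - d ^ p = l ^ p * e) (hcl : ¬ l ∣ c) (a : Ideal (𝓞 K)) (ha : Ideal.span {c} = a ^ p) :
    Algebra.IsUnramifiedAt (𝓞 K) Q := by
  have hp : p.Prime := Fact.out
  have hc0 : c ≠ 0 := by rintro rfl; exact hcl (dvd_zero _)
  by_cases hlQ : algebraMap (𝓞 K) (𝓞 L) l ∈ Q
  · have hle : Ideal.span {l} = Q.under (𝓞 K) := by
      refine hlmax.eq_of_le (Ideal.IsPrime.ne_top inferInstance) ?_
      rw [Ideal.span_singleton_le_iff_mem]
      exact hlQ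
    refine isUnramifiedAt_of_pow_sub_eq Q α hα c d e l w hc hl hw ?_ hcd ?_
    · intro h
      exact Ideal.IsPrime.ne_top ‹Q.IsPrime› (Ideal.eq_top_of_isUnit_mem _ h (hwu.map _))
    · intro h
      apply hcl
      rw [← Ideal.mem_span_singleton, hle]
      exact h
  -- Away from `l`, the generator `α` is traded for `x / α`, whose `p`-th power `y` is a unit at
  -- `Q`.
  · obtain ⟨x, y, hx0, hxy, hyq⟩ := exists_pow_eq_mul_notMem c hc0 a ha (Q.under (𝓞 K)) hp.ne_zero
    have hxL : algebraMap K L x ≠ 0 := by simpa using hx0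
    have hcL : algebraMap K L c ≠ 0 := by simpa using hc0
    have hα0 : α ≠ 0 := by
      rintro rfl
      rw [zero_pow hp.ne_zero] at hc
      exact hcL hc.symm
    refine isUnramifiedAt_of_pow_eq (p := p) Q (algebraMap K L x * α⁻¹) ?_ hp.ne_zero y ?_ hyq ?_
    · have hfin : FiniteDimensional K L := inferInstance
      have hαmem : α ∈ Algebra.adjoin K {algebraMap K L x * α⁻¹} := by
        have hinv := Subalgebra.inv_mem_of_algebraic
          (A := Algebra.adjoin K {algebraMap K L x * α⁻¹})
          (x := ⟨_, Algebra.self_mem_adjoin_singleton K _⟩) (Algebra.IsAlgebraic.isAlgebraic _)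
        have h2 := mul_mem (Subalgebra.algebraMap_mem
          (Algebra.adjoin K {algebraMap K L x * α⁻¹}) (x : K)) hinv
        convert h2 using 1
        simp only [mul_inv, inv_inv]
        rw [← mul_assoc, mul_inv_cancel₀ hxL, one_mul]
      rw [eq_top_iff, ← hα]
      exact Algebra.adjoin_le (Set.singleton_subset_iff.mpr hαmem)
    · rw [mul_pow, inv_pow, hc, ← map_pow]
      have : (x : K) ^ p = c * y := by exact_mod_cast congrArg (algebraMap (𝓞 K) K) hxy
      rw [this, map_mul, mul_comm, inv_mul_cancel_left₀ hcL]
    · rw [← map_natCast (algebraMap (𝓞 K) (𝓞 L)), ← hw, map_mul, map_pow]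
      intro h
      rcases Ideal.IsPrime.mem_or_mem ‹Q.IsPrime› h with h | h
      · exact hlQ (Ideal.IsPrime.mem_of_pow_mem ‹Q.IsPrime› _ h)
      · exact Ideal.IsPrime.ne_top ‹Q.IsPrime› (Ideal.eq_top_of_isUnit_mem _ h (hwu.map _))

/-! ### Kummer's reflection principle -/

/-- An extension with an automorphism whose order is the degree is cyclic. -/
theorem isGalois_and_commute_of_orderOf_eq_finrank {k E : Type*} [Field k] [Field E] [Algebra k E]
    [FiniteDimensional k E] (g : Gal(E/k)) (h : orderOf g = Module.finrank k E) :
    IsGalois k E ∧ ∀ a b : Gal(E/k), Commute a b := by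
  have h1 : Module.finrank k E ≤ Nat.card Gal(E/k) := by
    rw [← h]; exact orderOf_le_card
  have h2 : Nat.card Gal(E/k) ≤ Module.finrank k E := by
    rw [Nat.card_eq_fintype_card]; exact AlgEquiv.card_le
  refine ⟨IsGalois.of_card_aut_eq_finrank k E (le_antisymm h2 h1), fun a b => ?_⟩
  have htop : Subgroup.zpowers g = ⊤ :=
    Subgroup.eq_top_of_card_eq _ (by rw [Nat.card_zpowers, h]; exact le_antisymm h1 h2)
  obtain ⟨i, rfl⟩ := Subgroup.mem_zpowers_iff.mp (htop ▸ Subgroup.mem_top a : a ∈ Subgroup.zpowers g)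
  obtain ⟨j, rfl⟩ := Subgroup.mem_zpowers_iff.mp (htop ▸ Subgroup.mem_top b : b ∈ Subgroup.zpowers g)
  exact ((Commute.refl g).zpow_left i).zpow_right j

theorem ramificationIdx_dvd_finrank (F : Type*) [Field F] [NumberField F] [IsGalois ℚ F]
    (P : Ideal (𝓞 F)) [P.IsPrime] : P.ramificationIdx ℤ ∣ Module.finrank ℚ F := by
  have h := Ideal.ncard_primesOver_mul_ramificationIdxIn_mul_inertiaDegIn (P.under ℤ) (𝓞 F) Gal(F/ℚ)
  rw [IsGalois.card_aut_eq_finrank,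
    Ideal.ramificationIdxIn_eq_ramificationIdx (P.under ℤ) P Gal(F/ℚ)] at h
  rw [← h]
  exact dvd_mul_of_dvd_right (dvd_mul_right _ _) _

/-- Kummer's reflection principle, Galois theoretic part: an abelian extension of `ℚ` of degree
`p (p - 1)` is ramified over its subfields of degree `p - 1`. -/
theorem exists_not_isUnramifiedAt_of_commute {p : ℕ} [Fact p.Prime] {K L : Type*}
    [Field K] [NumberField K] [Field L] [NumberField L] [Algebra K L] [IsGalois ℚ K]
    (hK : Module.finrank ℚ K = p - 1) (hL : Module.finrank K L = p) (ρ τ : Gal(L/ℚ))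
    (hρ : orderOf ρ = p) (hτ : orderOf τ = p - 1) (hc : Commute ρ τ) :
    ∃ Q : Ideal (𝓞 L), ∃ _ : Q.IsPrime, ¬ Algebra.IsUnramifiedAt (𝓞 K) Q := by
  have hp : p.Prime := Fact.out
  have hcop : Nat.Coprime p (p - 1) := by
    have := Nat.coprime_self_add_left (m := p - 1) (n := 1)
    rw [Nat.sub_add_cancel hp.one_le] at this
    exact this.mpr (Nat.coprime_one_left _)
  have hfin : Module.finrank ℚ L = p * (p - 1) := by
    rw [← Module.finrank_mul_finrank ℚ K L, hK, hL, mul_comm]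
  obtain ⟨hgal, hcomm⟩ := isGalois_and_commute_of_orderOf_eq_finrank (ρ * τ) (by
    rw [hc.orderOf_mul_eq_mul_orderOf_of_coprime (by rwa [hρ, hτ]), hρ, hτ, hfin])
  let H := Subgroup.zpowers τ
  have hH : H.Normal := ⟨fun a ha b => by rwa [(hcomm b a).eq, mul_inv_cancel_right]⟩
  -- `F` has degree `p` over `ℚ`, so Minkowski's theorem gives it a ramified prime.
  let F := IntermediateField.fixedField H
  have hFgal : IsGalois ℚ F := IsGalois.of_fixedField_normal_subgroup H
  have hFL : Module.finrank F L = p - 1 := by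
    rw [IntermediateField.finrank_fixedField_eq_card, Nat.card_zpowers, hτ]
  have hF : Module.finrank ℚ F = p := by
    have h1 := Module.finrank_mul_finrank ℚ F L
    rw [hFL, hfin] at h1
    exact Nat.eq_of_mul_eq_mul_right (Nat.sub_pos_of_lt hp.one_lt) h1
  by_contra! hunr
  obtain ⟨P, hPmax, hP⟩ := NumberField.exists_not_isUnramifiedAt_int (K := F) (𝒪 := 𝓞 F)
    (by rw [hF]; exact hp.ne_one)
  obtain ⟨⟨Q, hQ, hQP⟩⟩ := (inferInstance : Nonempty (Ideal.primesOver P (𝓞 L)))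
  have := hunr Q hQ
  apply hP
  rw [← Ideal.ramificationIdx_eq_one_iff]
  -- If `L / K` is unramified, the index of `P` divides both `[F : ℚ] = p` and `[K : ℚ] = p - 1`.
  have h1 : P.ramificationIdx ℤ ∣ Q.ramificationIdx ℤ := Ideal.ramificationIdx_below_dvd P Q
  have h2 : Q.ramificationIdx ℤ = (Q.under (𝓞 K)).ramificationIdx ℤ := by
    rw [Ideal.ramificationIdx_tower (Q.under (𝓞 K)) Q, Ideal.ramificationIdx_eq_one Q (𝓞 K),
      mul_one]
  have h3 := ramificationIdx_dvd_finrank K (Q.under (𝓞 K))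
  have h4 := ramificationIdx_dvd_finrank F P
  rw [hK] at h3
  rw [hF] at h4
  exact Nat.eq_one_of_dvd_coprimes hcop h4 (h1.trans (h2 ▸ h3))

open Polynomial in
/-- If `c` is not a `p`-th power and `σ c = c ^ n * y ^ p`, where `σ` acts on the `p`-th roots of
unity as the `n`-th power map, then `K(c ^ (1 / p))` is ramified over `K` at some prime. -/
theorem exists_not_isUnramifiedAt_kummer.{u} {p : ℕ} [Fact p.Prime] {K : Type u} [Field K]
    [NumberField K] [IsGalois ℚ K] (hK : Module.finrank ℚ K = p - 1) {ζ : K}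
    (hζ : IsPrimitiveRoot ζ p) (σ : Gal(K/ℚ)) (hσ : orderOf σ = p - 1) (n : ℕ)
    (hσζ : σ ζ = ζ ^ n) (c y : K) (hc : ∀ b : K, b ^ p ≠ c) (hσc : σ c = c ^ n * y ^ p) :
    ∃ (L : Type u) (_ : Field L) (_ : NumberField L) (_ : Algebra K L) (α : L),
      α ^ p = algebraMap K L c ∧ Algebra.adjoin K {α} = ⊤ ∧
      ∃ Q : Ideal (𝓞 L), ∃ _ : Q.IsPrime, ¬ Algebra.IsUnramifiedAt (𝓞 K) Q := by
  have hp : p.Prime := Fact.out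
  have hirr : Irreducible (X ^ p - C c) := X_pow_sub_C_irreducible_of_prime hp hc
  have hfact : Fact (Irreducible (X ^ p - C c)) := ⟨hirr⟩
  have hmonic : (X ^ p - C c).Monic := monic_X_pow_sub_C c hp.ne_zero
  let L := AdjoinRoot (X ^ p - C c)
  have hfinKL : Module.Finite K L := hmonic.finite_adjoinRoot
  have hnf : NumberField L := NumberField.of_module_finite K L
  let α : L := AdjoinRoot.root (X ^ p - C c)
  have hα : α ^ p = algebraMap K L c := by
    have h := AdjoinRoot.eval₂_root (X ^ p - C c)
    rw [eval₂_sub, eval₂_X_pow, eval₂_C, sub_eq_zero] at h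
    exact h
  have hadj : Algebra.adjoin K {α} = ⊤ := AdjoinRoot.adjoinRoot_eq_top
  have hrank : Module.finrank K L = p := by
    rw [(AdjoinRoot.powerBasis hirr.ne_zero).finrank, AdjoinRoot.powerBasis_dim,
      natDegree_X_pow_sub_C]
  have hlift : ∀ (f : Gal(K/ℚ)) (z : L), z ^ p = algebraMap K L (f c) →
      ∃ g : Gal(L/ℚ), g α = z ∧ ∀ x : K, g (algebraMap K L x) = algebraMap K L (f x) := by
    intro f z hz
    have hev : eval₂ ((algebraMap K L).comp (f : K →+* K)) z (X ^ p - C c) = 0 := by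
      rw [eval₂_sub, eval₂_X_pow, eval₂_C, hz, sub_eq_zero]; rfl
    let g : L →+* L := AdjoinRoot.lift ((algebraMap K L).comp (f : K →+* K)) z hev
    refine ⟨AlgEquiv.ofBijective g.toRatAlgHom (Algebra.IsAlgebraic.algHom_bijective _), ?_, ?_⟩
    · exact AdjoinRoot.lift_root hev
    · intro x
      exact AdjoinRoot.lift_of hev
  have hext : ∀ g h : Gal(L/ℚ), g α = h α →
      (∀ x : K, g (algebraMap K L x) = h (algebraMap K L x)) → g = h := by
    intro g h h1 h2
    have h3 : (g : L →+* L) = (h : L →+* L) := AdjoinRoot.ringHom_ext (RingHom.ext h2) h1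
    exact AlgEquiv.ext fun x => RingHom.congr_fun h3 x
  have hζL : IsPrimitiveRoot (algebraMap K L ζ) p :=
    hζ.map_of_injective (FaithfulSMul.algebraMap_injective K L)
  have hα0 : α ≠ 0 := by
    intro h0
    rw [h0, zero_pow hp.ne_zero] at hα
    refine hc 0 ?_
    rw [zero_pow hp.ne_zero]
    exact ((map_eq_zero (algebraMap K L)).mp hα.symm).symm
  -- `ρ` generates the Kummer group and `τ` lifts `σ`. They commute because `σ` acts on `ζ` by the
  -- same exponent `n` as on `c` modulo `p`-th powers.
  obtain ⟨ρ, hρα, hρK⟩ := hlift 1 (algebraMap K L ζ * α) (by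
    rw [mul_pow, hζL.pow_eq_one, one_mul, hα]; rfl)
  obtain ⟨τ, hτα, hτK⟩ := hlift σ (α ^ n * algebraMap K L y) (by
    rw [mul_pow, ← pow_mul, mul_comm n, pow_mul, hα, hσc, map_mul, map_pow, map_pow])
  have hρpowK : ∀ (i : ℕ) (x : K), (ρ ^ i) (algebraMap K L x) = algebraMap K L x := by
    intro i x
    induction i with
    | zero => rfl
    | succ i ih => rw [pow_succ, AlgEquiv.mul_apply, hρK]; exact ih
  have hρpow : ∀ i : ℕ, (ρ ^ i) α = algebraMap K L ζ ^ i * α := by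
    intro i
    induction i with
    | zero => simp
    | succ i ih => rw [pow_succ, AlgEquiv.mul_apply, hρα, map_mul, hρpowK, ih]; ring
  have hτpowK : ∀ (i : ℕ) (x : K), (τ ^ i) (algebraMap K L x) = algebraMap K L ((σ ^ i) x) := by
    intro i
    induction i with
    | zero => intro x; rfl
    | succ i ih => intro x; rw [pow_succ, AlgEquiv.mul_apply, hτK, ih, pow_succ]; rfl
  have hρorder : orderOf ρ = p := by
    refine orderOf_eq_prime ?_ ?_
    · refine hext _ _ ?_ fun x => by rw [hρpowK]; rfl
      rw [hρpow, hζL.pow_eq_one, one_mul]; rfl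
    · intro h1
      rw [h1] at hρα
      have : algebraMap K L ζ = 1 := by
        refine mul_right_cancel₀ hα0 ?_
        rw [one_mul, ← hρα]; rfl
      exact hζL.ne_one hp.one_lt this
  have hcomm : Commute ρ τ := by
    refine hext _ _ ?_ fun x => ?_
    · rw [AlgEquiv.mul_apply, AlgEquiv.mul_apply, hτα, hρα, map_mul, map_pow, hρα, map_mul, hτα,
        hτK, hρK, hσζ, map_pow, mul_pow, mul_assoc]
      rfl
    · rw [AlgEquiv.mul_apply, AlgEquiv.mul_apply, hρK, AlgEquiv.one_apply, hτK, hρK]; rfl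
  have hτ1 : ∃ j : ℕ, τ ^ (p - 1) = ρ ^ j := by
    have hσ1 : σ ^ (p - 1) = 1 := by rw [← hσ]; exact pow_orderOf_eq_one σ
    have h1 : ((τ ^ (p - 1)) α / α) ^ p = 1 := by
      rw [div_pow, ← map_pow, hα, hτpowK, hσ1, AlgEquiv.one_apply]
      refine div_self ?_
      rw [← hα]; exact pow_ne_zero _ hα0
    have : NeZero p := ⟨hp.ne_zero⟩
    obtain ⟨j, -, hj⟩ := hζL.eq_pow_of_pow_eq_one h1
    refine ⟨j, hext _ _ ?_ fun x => ?_⟩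
    · rw [hρpow, hj, div_mul_cancel₀ _ hα0]
    · rw [hρpowK, hτpowK, hσ1]; rfl
  obtain ⟨j, hj⟩ := hτ1
  -- `τ ^ (p - 1)` is only known to be a power of `ρ`; passing to `τ ^ p` removes this `p`-part, and
  -- `p` is prime to `p - 1`.
  have hτorder : orderOf (τ ^ p) = p - 1 := by
    apply Nat.dvd_antisymm
    · apply orderOf_dvd_of_pow_eq_one
      rw [← pow_mul, mul_comm, pow_mul, hj, ← pow_mul, mul_comm, pow_mul,
        orderOf_dvd_iff_pow_eq_one.mp hρorder.dvd, one_pow]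
    · have h1 : (τ ^ p) ^ orderOf (τ ^ p) = 1 := pow_orderOf_eq_one _
      rw [← pow_mul] at h1
      have h2 : σ ^ (p * orderOf (τ ^ p)) = 1 := by
        ext x
        apply FaithfulSMul.algebraMap_injective K L
        rw [← hτpowK, h1]; rfl
      have h3 := orderOf_dvd_of_pow_eq_one h2
      rw [hσ] at h3
      refine Nat.Coprime.dvd_of_dvd_mul_left ?_ h3
      have := Nat.coprime_self_add_right (m := p - 1) (n := 1)
      rw [Nat.sub_add_cancel hp.one_le] at this
      exact this.mpr (Nat.coprime_one_right _)
  exact ⟨L, inferInstance, hnf, inferInstance, α, hα, hadj,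
    exists_not_isUnramifiedAt_of_commute hK hrank ρ (τ ^ p) hρorder hτorder (hcomm.pow_right p)⟩

/-! ### Divisibility in the localization at a prime element -/

section LocalDvd

variable {K : Type*} [Field K]

/-- `l ^ k` divides `x` in the localization of `𝓞 K` at the prime element `l`. -/
def LocalDvd (l : 𝓞 K) (k : ℕ) (x : K) : Prop :=
  ∃ a s : 𝓞 K, ¬ l ∣ s ∧ algebraMap (𝓞 K) K s * x = algebraMap (𝓞 K) K (l ^ k * a)

theorem localDvd_iff_congMod (l : 𝓞 K) (k : ℕ) (x y : K) :
    CycSing.CongMod (Ideal.span {l}) k x y ↔ LocalDvd l k (x - y) := by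
  constructor
  · rintro ⟨a, ha, s, hs, h⟩
    rw [Ideal.span_singleton_pow, Ideal.mem_span_singleton] at ha
    obtain ⟨c, rfl⟩ := ha
    exact ⟨c, s, fun h' => hs (Ideal.mem_span_singleton.mpr h'), h⟩
  · rintro ⟨a, s, hs, h⟩
    refine ⟨l ^ k * a, ?_, s, fun h' => hs (Ideal.mem_span_singleton.mp h'), h⟩
    rw [Ideal.span_singleton_pow, Ideal.mem_span_singleton]
    exact dvd_mul_right _ _

namespace LocalDvd

variable {l : 𝓞 K} {j k : ℕ} {x y : K}

theorem mono (h : LocalDvd l k x) (hjk : j ≤ k) : LocalDvd l j x := by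
  obtain ⟨a, s, hs, h⟩ := h
  refine ⟨l ^ (k - j) * a, s, hs, ?_⟩
  rw [h, ← mul_assoc, ← pow_add, Nat.add_sub_cancel' hjk]

theorem of_dvd (hl : Prime l) {a : 𝓞 K} (h : l ^ k ∣ a) : LocalDvd l k (algebraMap (𝓞 K) K a) := by
  obtain ⟨c, rfl⟩ := h
  exact ⟨c, 1, fun h => hl.not_isUnit (isUnit_of_dvd_one h), by rw [map_one, one_mul]⟩

theorem coe (hl : Prime l) (a : 𝓞 K) : LocalDvd l 0 (algebraMap (𝓞 K) K a) :=
  of_dvd hl (by rw [pow_zero]; exact one_dvd _)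

theorem intCast (hl : Prime l) (n : ℤ) : LocalDvd l 0 (n : K) := by
  have := coe hl (n : 𝓞 K)
  rwa [map_intCast] at this

theorem natCast (hl : Prime l) (n : ℕ) : LocalDvd l 0 (n : K) := by
  have := coe hl (n : 𝓞 K)
  rwa [map_natCast] at this

theorem one (hl : Prime l) : LocalDvd l 0 (1 : K) := by
  simpa using natCast hl 1

theorem zero (hl : Prime l) : LocalDvd l k (0 : K) := by
  simpa using of_dvd hl (dvd_zero (l ^ k))

theorem dvd (hl : Prime l) {a : 𝓞 K} (h : LocalDvd l k (algebraMap (𝓞 K) K a)) : l ^ k ∣ a := by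
  obtain ⟨c, s, hs, h⟩ := h
  rw [← map_mul] at h
  have h := FaithfulSMul.algebraMap_injective (𝓞 K) K h
  exact hl.pow_dvd_of_dvd_mul_left k hs ⟨c, h⟩

theorem inv_coe {a : 𝓞 K} (h : ¬ l ∣ a) : LocalDvd l 0 (algebraMap (𝓞 K) K a)⁻¹ := by
  have ha : algebraMap (𝓞 K) K a ≠ 0 := by
    intro h0
    rw [map_eq_zero_iff _ (FaithfulSMul.algebraMap_injective (𝓞 K) K)] at h0
    exact h (h0 ▸ dvd_zero l)
  exact ⟨1, a, h, by rw [mul_inv_cancel₀ ha, pow_zero, one_mul, map_one]⟩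

theorem add (hl : Prime l) (hx : LocalDvd l k x) (hy : LocalDvd l k y) : LocalDvd l k (x + y) := by
  obtain ⟨a, s, hs, h⟩ := hx
  obtain ⟨b, t, ht, h'⟩ := hy
  refine ⟨t * a + s * b, s * t, fun hd => (hl.dvd_or_dvd hd).elim hs ht, ?_⟩
  simp only [map_mul, map_add] at h h' ⊢
  linear_combination algebraMap (𝓞 K) K t * h + algebraMap (𝓞 K) K s * h'

theorem mul (hl : Prime l) (hx : LocalDvd l j x) (hy : LocalDvd l k y) :
    LocalDvd l (j + k) (x * y) := by
  obtain ⟨a, s, hs, h⟩ := hx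
  obtain ⟨b, t, ht, h'⟩ := hy
  refine ⟨a * b, s * t, fun hd => (hl.dvd_or_dvd hd).elim hs ht, ?_⟩
  simp only [map_mul, map_pow, pow_add] at h h' ⊢
  linear_combination algebraMap (𝓞 K) K t * y * h +
    (algebraMap (𝓞 K) K l ^ j * algebraMap (𝓞 K) K a) * h'

theorem mul_left (hl : Prime l) (hx : LocalDvd l 0 x) (hy : LocalDvd l k y) :
    LocalDvd l k (x * y) := by
  simpa using hx.mul hl hy

theorem neg (hx : LocalDvd l k x) : LocalDvd l k (-x) := by
  obtain ⟨a, s, hs, h⟩ := hx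
  refine ⟨-a, s, hs, ?_⟩
  simp only [map_mul, map_neg] at h ⊢
  linear_combination -h

theorem sub (hl : Prime l) (hx : LocalDvd l k x) (hy : LocalDvd l k y) : LocalDvd l k (x - y) := by
  rw [sub_eq_add_neg]; exact hx.add hl hy.neg

theorem pow (hl : Prime l) (hx : LocalDvd l 0 x) (n : ℕ) : LocalDvd l 0 (x ^ n) := by
  induction n with
  | zero => rw [pow_zero]; exact one hl
  | succ n ih => rw [pow_succ]; exact ih.mul_left hl hx

/-- The localization is integrally closed: for a denominator `s` of `x ^ n`, the element `s * x` is
already integral. -/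
theorem of_pow {n : ℕ} (hn : n ≠ 0) (h : LocalDvd l 0 (x ^ n)) : LocalDvd l 0 x := by
  obtain ⟨a, s, hs, h⟩ := h
  have hint : IsIntegral ℤ (algebraMap (𝓞 K) K s * x) := by
    refine IsIntegral.of_pow (Nat.pos_of_ne_zero hn) ?_
    have h2 : (algebraMap (𝓞 K) K s * x) ^ n =
        algebraMap (𝓞 K) K (s ^ (n - 1) * a) := by
      rw [map_mul, map_pow]
      simp only [pow_zero, one_mul] at h
      rw [mul_pow, ← h]
      nth_rewrite 1 [← Nat.sub_add_cancel (Nat.pos_of_ne_zero hn)]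
      ring
    rw [h2]
    exact RingOfIntegers.isIntegral_coe _
  let z : 𝓞 K := ⟨_, hint⟩
  have hz : algebraMap (𝓞 K) K z = algebraMap (𝓞 K) K s * x := rfl
  exact ⟨z, s, hs, by rw [pow_zero, one_mul, hz]⟩

/-- Division by the uniformizer. -/
theorem exists_eq_mul (hl : Prime l) (h : LocalDvd l (k + 1) x) :
    ∃ z, x = algebraMap (𝓞 K) K l * z ∧ LocalDvd l k z := by
  have hl0 : algebraMap (𝓞 K) K l ≠ 0 := by
    simpa using hl.ne_zero
  obtain ⟨a, s, hs, h⟩ := h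
  refine ⟨x / algebraMap (𝓞 K) K l, by rw [mul_div_cancel₀ _ hl0], a, s, hs, ?_⟩
  rw [← mul_div_assoc, div_eq_iff hl0, h, ← map_mul]
  congr 1; ring

/-- If `n` is prime to `p` and `l ∣ p`, multiplication by `n` does not change divisibility. -/
theorem of_intCast_mul (hl : Prime l) {p : ℕ} (hp : p.Prime) (hlp : l ∣ p) {n : ℤ}
    (hn : ¬ (p : ℤ) ∣ n) (hx : LocalDvd l k x) (h : LocalDvd l (k + 1) (n * x)) :
    LocalDvd l (k + 1) x := by
  obtain ⟨a, b, hab⟩ :=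
    (Nat.prime_iff_prime_int.mp hp).irreducible.coprime_iff_not_dvd.mpr hn
  have h1 : x = (a : K) * ((p : K) * x) + b * (n * x) := by
    have : (a : K) * p + b * n = 1 := by exact_mod_cast congrArg (Int.cast : ℤ → K) hab
    linear_combination -x * this
  have hp1 : LocalDvd l 1 (p : K) := by
    have := of_dvd (k := 1) hl (by simpa using hlp : l ^ 1 ∣ (p : 𝓞 K))
    rwa [map_natCast] at this
  rw [h1]
  refine (mul_left hl (intCast hl a) ?_).add hl (mul_left hl (intCast hl b) h)
  rw [add_comm k 1]
  exact hp1.mul hl hx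

theorem map [CharZero K] (σ : K ≃ₐ[ℚ] K)
    (hσ : Associated (RingOfIntegers.mapRingEquiv σ.toRingEquiv l) l) (hx : LocalDvd l k x) :
    LocalDvd l k (σ x) := by
  obtain ⟨a, s, hs, h⟩ := hx
  set f := RingOfIntegers.mapRingEquiv σ.toRingEquiv with hf
  have hfσ : ∀ z : 𝓞 K, algebraMap (𝓞 K) K (f z) = σ (algebraMap (𝓞 K) K z) := fun z => rfl
  obtain ⟨w, hw⟩ := hσ.symm
  refine ⟨w ^ k * f a, f s, fun hd => hs ?_, ?_⟩
  · rw [← map_dvd_iff f]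
    exact hσ.dvd.trans hd
  · rw [hfσ, ← map_mul σ, h, ← hfσ, map_mul f, map_pow, ← hw]
    congr 1; ring

end LocalDvd

end LocalDvd

namespace LocalDvd

section General

variable {K : Type*} [Field K] {l : 𝓞 K} {k : ℕ}

/-- The localization of `𝓞 K` at a prime element, as a subring of `K`. -/
def localSubring (hl : Prime l) : Subring K where
  carrier := {x | LocalDvd l 0 x}
  zero_mem' := zero hl
  one_mem' := one hl
  add_mem' := fun hx hy => hx.add hl hy
  mul_mem' := fun hx hy => hx.mul_left hl hy
  neg_mem' := neg

/-- Terms of order two in `C - 1` lie in `π ^ (2 * k)`, and `2 * k ≥ k + 1`. -/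
theorem pow_sub_one_sub_mul (hl : Prime l) (hk : 1 ≤ k) {C : K} (hC : LocalDvd l k (C - 1)) (n : ℕ) :
    LocalDvd l (k + 1) (C ^ n - 1 - n * (C - 1)) := by
  have hC0 : LocalDvd l 0 C := by
    have := (hC.mono (Nat.zero_le k)).add hl (one hl)
    rwa [sub_add_cancel] at this
  induction n with
  | zero => simpa using zero hl
  | succ n ih =>
    have h1 : C ^ (n + 1) - 1 - ((n + 1 : ℕ) : K) * (C - 1) =
        C * (C ^ n - 1 - n * (C - 1)) + n * ((C - 1) * (C - 1)) := by
      push_cast; ring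
    rw [h1]
    exact (hC0.mul_left hl ih).add hl
      ((natCast hl n).mul_left hl ((hC.mul hl hC).mono (by omega)))

end General

theorem associated_map {p : ℕ} [NeZero p] {K : Type*} [Field K] [NumberField K] {ζ : K}
    (hζ : IsPrimitiveRoot ζ p) (σ : K ≃ₐ[ℚ] K) :
    Associated (RingOfIntegers.mapRingEquiv σ.toRingEquiv (hζ.toInteger - 1)) (hζ.toInteger - 1) :=
  (hζ.toInteger_isPrimitiveRoot.associated_sub_one_map_sub_one
    (AlgEquiv.ofRingEquiv (f := RingOfIntegers.mapRingEquiv σ.toRingEquiv)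
      fun n : ℤ => map_intCast _ n)).symm

/-! ### Congruences modulo powers of `ζ - 1` -/

section Cyclotomic

variable {p : ℕ} [Fact p.Prime] {K : Type*} [Field K] [NumberField K]
  [IsCyclotomicExtension {p} ℚ K] {ζ : K} (hζ : IsPrimitiveRoot ζ p)

theorem zeta_sub_one : LocalDvd (hζ.toInteger - 1) 1 (ζ - 1) := by
  have := of_dvd (k := 1) hζ.zeta_sub_one_prime' (dvd_of_eq (pow_one _))
  rw [map_sub, map_one] at this
  exact this

/-- The ring of integers is `ℤ[ζ]` and `ζ ≡ 1`, so the residue field is the prime field. -/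
theorem exists_int_dvd_sub (a : 𝓞 K) : ∃ n : ℤ, hζ.toInteger - 1 ∣ a - n := by
  have : IsCyclotomicExtension {p ^ (0 + 1)} ℚ K := by simpa using ‹IsCyclotomicExtension {p} ℚ K›
  have hζ' : IsPrimitiveRoot ζ (p ^ (0 + 1)) := by simpa using hζ
  have htop := hζ'.integralPowerBasisOfPrimePow.adjoin_gen_eq_top
  rw [hζ'.integralPowerBasisOfPrimePow_gen] at htop
  have ha : a ∈ Algebra.adjoin ℤ {hζ'.toInteger} := htop ▸ Algebra.mem_top
  induction ha using Algebra.adjoin_induction with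
  | mem x hx =>
    rw [Set.mem_singleton_iff] at hx
    subst hx
    exact ⟨1, by rw [Int.cast_one]⟩
  | algebraMap r => exact ⟨r, by simp⟩
  | add x y _ _ hx hy =>
    obtain ⟨m, hm⟩ := hx
    obtain ⟨n, hn⟩ := hy
    refine ⟨m + n, ?_⟩
    have := dvd_add hm hn
    push_cast
    rwa [add_sub_add_comm]
  | mul x y _ _ hx hy =>
    obtain ⟨m, hm⟩ := hx
    obtain ⟨n, hn⟩ := hy
    refine ⟨m * n, ?_⟩
    have := dvd_add (dvd_mul_of_dvd_left hm y) (dvd_mul_of_dvd_right hn (m : 𝓞 K))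
    push_cast
    convert this using 1
    ring

theorem natCast_prime : LocalDvd (hζ.toInteger - 1) (p - 1) (p : K) := by
  have := of_dvd hζ.zeta_sub_one_prime'
    (IsCyclotomicExtension.Rat.associated_zeta_sub_one_pow_prime p hζ).dvd
  rwa [map_natCast] at this

theorem one_intCast_iff {n : ℤ} : LocalDvd (hζ.toInteger - 1) 1 (n : K) ↔ (p : ℤ) ∣ n := by
  rw [← IsCyclotomicExtension.Rat.zeta_sub_one_dvd_intCast_iff' p hζ,
    ← map_intCast (algebraMap (𝓞 K) K)]
  constructor
  · intro h
    simpa using dvd hζ.zeta_sub_one_prime' h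
  · intro h
    exact of_dvd hζ.zeta_sub_one_prime' (by simpa using h)

theorem intCast_of_dvd {n : ℤ} (m : ℕ) (h : (p : ℤ) ^ m ∣ n) :
    LocalDvd (hζ.toInteger - 1) (m * (p - 1)) (n : K) := by
  have hl := hζ.zeta_sub_one_prime'
  obtain ⟨c, rfl⟩ := h
  rw [← map_intCast (algebraMap (𝓞 K) K)]
  refine of_dvd hl ?_
  push_cast
  refine Dvd.dvd.mul_right ?_ _
  rw [mul_comm, pow_mul]
  exact pow_dvd_pow_of_dvd
    (IsCyclotomicExtension.Rat.associated_zeta_sub_one_pow_prime p hζ).dvd m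

theorem exists_int {x : K} (hx : LocalDvd (hζ.toInteger - 1) 0 x) :
    ∃ n : ℤ, LocalDvd (hζ.toInteger - 1) 1 (x - n) := by
  have hl := hζ.zeta_sub_one_prime'
  have hp : p.Prime := Fact.out
  obtain ⟨a, s, hs, h⟩ := hx
  obtain ⟨ca, hca⟩ := exists_int_dvd_sub hζ a
  obtain ⟨cs, hcs⟩ := exists_int_dvd_sub hζ s
  have hcs' : ¬ (p : ℤ) ∣ cs := by
    rw [← IsCyclotomicExtension.Rat.zeta_sub_one_dvd_intCast_iff' p hζ]
    intro h'
    exact hs (by simpa using dvd_add hcs h')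
  obtain ⟨t, m, htm⟩ :=
    (Nat.prime_iff_prime_int.mp hp).irreducible.coprime_iff_not_dvd.mpr hcs'
  have hlp : hζ.toInteger - 1 ∣ ((p : ℤ) : 𝓞 K) :=
    (IsCyclotomicExtension.Rat.zeta_sub_one_dvd_intCast_iff' p hζ).mpr dvd_rfl
  have h2 : hζ.toInteger - 1 ∣ a - s * ((m * ca : ℤ) : 𝓞 K) := by
    have h3 : ((t : 𝓞 K) * (p : ℤ) + m * cs) = 1 := by
      exact_mod_cast congrArg (Int.cast : ℤ → 𝓞 K) htm
    have h4 : a - s * ((m * ca : ℤ) : 𝓞 K) =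
        (a - ca) - (s - cs) * (m * ca) + ((p : ℤ) : 𝓞 K) * (t * ca) := by
      push_cast at h3 ⊢
      linear_combination (-(ca : 𝓞 K)) * h3
    rw [h4]
    exact dvd_add (dvd_sub hca (dvd_mul_of_dvd_left hcs _)) (dvd_mul_of_dvd_left hlp _)
  obtain ⟨b, hb⟩ := h2
  refine ⟨m * ca, b, s, hs, ?_⟩
  rw [pow_one, ← hb, mul_sub, h, pow_zero, one_mul, map_sub, map_mul, map_intCast]

theorem exists_int_pow {y : K} (hy : LocalDvd (hζ.toInteger - 1) 0 y) :
    ∃ d : ℤ, LocalDvd (hζ.toInteger - 1) p (y ^ p - (d : K) ^ p) ∧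
      LocalDvd (hζ.toInteger - 1) 1 (y - d) := by
  have hl := hζ.zeta_sub_one_prime'
  have hp : p.Prime := Fact.out
  obtain ⟨d, hd⟩ := exists_int hζ hy
  refine ⟨d, ?_, hd⟩
  -- Expanding `(d + (y - d)) ^ p` inside the local ring, the mixed term has valuation at least `(p
  -- - 1) + 1`.
  obtain ⟨r, hr⟩ := exists_add_pow_prime_eq hp (⟨d, intCast hl d⟩ : localSubring hl)
    ⟨y - d, hd.mono zero_le_one⟩
  have hr' : y ^ p = (d : K) ^ p + (y - d) ^ p + p * d * (y - d) * (r : K) := by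
    have := congrArg (Subtype.val) hr
    push_cast at this
    rwa [add_sub_cancel] at this
  have hpow : LocalDvd (hζ.toInteger - 1) p ((y - d) ^ p) := by
    obtain ⟨z, hz, hz0⟩ := exists_eq_mul hl hd
    rw [hz, mul_pow]
    have := (of_dvd hl (dvd_refl ((hζ.toInteger - 1) ^ p))).mul hl (pow hl hz0 p)
    rwa [map_pow] at this
  have hmix : LocalDvd (hζ.toInteger - 1) p (p * d * (y - d) * (r : K)) := by
    have h1 := (((natCast_prime hζ).mul hl (intCast hl d)).mul hl hd).mul hl (show LocalDvd _ 0 (r : K) from r.2)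
    have hp1 : p - 1 + 0 + 1 + 0 = p := by have := hp.one_le; omega
    rwa [hp1] at h1
  have h2 : y ^ p - (d : K) ^ p = (y - d) ^ p + p * d * (y - d) * (r : K) := by
    rw [hr']; ring
  rw [h2]
  exact hpow.add hl hmix

/-- A root of unity which is congruent to a `p`-th power modulo `(ζ - 1) ^ 2` is trivial. -/
theorem eq_one_of_pow_sub {y : K} (hy : LocalDvd (hζ.toInteger - 1) 0 y) {i : ℕ}
    (h : LocalDvd (hζ.toInteger - 1) 2 (y ^ p - ζ ^ i)) :
    ζ ^ i = 1 ∧ LocalDvd (hζ.toInteger - 1) p (y ^ p - 1) := by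
  have hl := hζ.zeta_sub_one_prime'
  have hp : p.Prime := Fact.out
  have h2p : 2 ≤ p := hp.two_le
  obtain ⟨d, hd, -⟩ := exists_int_pow hζ hy
  have hζi := pow_sub_one_sub_mul hl le_rfl (zeta_sub_one hζ) i
  have hζi1 : LocalDvd (hζ.toInteger - 1) 1 (ζ ^ i - 1) := by
    have := (hζi.mono one_le_two).add hl ((natCast hl i).mul_left hl (zeta_sub_one hζ))
    rwa [sub_add_cancel] at this
  have hdζ : LocalDvd (hζ.toInteger - 1) 2 ((d : K) ^ p - ζ ^ i) := by
    have := h.sub hl (hd.mono h2p)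
    rwa [sub_sub_sub_cancel_left, ] at this
  have hd1 : (p : ℤ) ∣ d ^ p - 1 := by
    rw [← one_intCast_iff hζ]
    push_cast
    have := (hdζ.mono one_le_two).add hl hζi1
    rwa [sub_add_sub_cancel] at this
  have hd2 : (p : ℤ) ∣ d - 1 := by
    rw [← ZMod.intCast_zmod_eq_zero_iff_dvd] at hd1 ⊢
    push_cast at hd1 ⊢
    rwa [ZMod.pow_card] at hd1
  -- Fermat gave `d ≡ 1 mod p`, and the `p`-th power gains a factor `p`; the valuation `2 * (p - 1)`
  -- of `p ^ 2` is at least `p`.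
  have hd3 : (p : ℤ) ^ 2 ∣ d ^ p - 1 := by
    have := dvd_sub_pow_of_dvd_sub hd2 1
    simpa using this
  have hd4 : LocalDvd (hζ.toInteger - 1) p ((d : K) ^ p - 1) := by
    have := (intCast_of_dvd hζ 2 hd3).mono (show p ≤ 2 * (p - 1) by omega)
    push_cast at this
    exact this
  constructor
  · have h3 : LocalDvd (hζ.toInteger - 1) 2 ((i : K) * (ζ - 1)) := by
      have h4 := ((hd4.mono h2p).sub hl hdζ).sub hl hζi
      convert h4 using 1
      ring
    by_contra hne
    have hpi : ¬ (p : ℤ) ∣ (i : ℤ) := by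
      intro hdvd
      exact hne ((hζ.pow_eq_one_iff_dvd i).mpr (by exact_mod_cast hdvd))
    have h5 := of_intCast_mul hl hp hζ.toInteger_sub_one_dvd_prime' hpi
      (zeta_sub_one hζ) (by simpa using h3)
    have h6 : LocalDvd (hζ.toInteger - 1) 2 (algebraMap (𝓞 K) K (hζ.toInteger - 1)) := by
      rw [map_sub, map_one]; exact h5
    have h7 := dvd hl h6
    exact hl.not_isUnit (isUnit_of_dvd_one (by
      rw [sq] at h7
      exact (mul_dvd_mul_iff_left hl.ne_zero).mp (by simpa using h7)))
  · have := hd.add hl hd4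
    rwa [sub_add_sub_cancel] at this

/-- `σ` is trivial on the residue field and `ζ ^ u - 1 ≡ u * (ζ - 1) mod π ^ 2`, so each factor `ζ -
1` contributes one `u`. -/
theorem map_sub_pow_mul {σ : K ≃ₐ[ℚ] K} {u : ℕ} (hσ : σ ζ = ζ ^ u) {k : ℕ} {x : K}
    (hx : LocalDvd (hζ.toInteger - 1) k x) :
    LocalDvd (hζ.toInteger - 1) (k + 1) (σ x - (u : K) ^ k * x) := by
  have hl := hζ.zeta_sub_one_prime'
  induction k generalizing x with
  | zero =>
    obtain ⟨n, hn⟩ := exists_int hζ hx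
    have := (hn.map σ (associated_map hζ σ)).sub hl hn
    rw [map_sub, map_intCast] at this
    simpa using this
  | succ k ih =>
    obtain ⟨z, rfl, hz⟩ := exists_eq_mul hl hx
    have hll : algebraMap (𝓞 K) K (hζ.toInteger - 1) = ζ - 1 := by
      rw [map_sub, map_one]; rfl
    rw [hll, map_mul, map_sub, map_one, hσ]
    have h1 := ih hz
    have h2 := pow_sub_one_sub_mul hl le_rfl (zeta_sub_one hζ) u
    have h3 := (h2.mul hl (hz.map σ (associated_map hζ σ)))
    have h4 := (natCast hl u).mul_left hl ((zeta_sub_one hζ).mul hl h1)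
    have h5 := (h3.mono (show k + 1 + 1 ≤ 1 + 1 + k by omega)).add hl
      (h4.mono (show k + 1 + 1 ≤ 1 + (k + 1) by omega))
    convert h5 using 1
    ring

/-- If `σ C ≡ C ^ n mod (ζ - 1) ^ p` and `C ≡ 1 mod (ζ - 1) ^ 2`, then either
`C ≡ 1 mod (ζ - 1) ^ p`, or the exact power of `ζ - 1` dividing `C - 1` is determined by `n`. -/
theorem exists_exact {σ : K ≃ₐ[ℚ] K} {u : ℕ} (hσ : σ ζ = ζ ^ u) {n : ℕ} {C Y : K}
    (hC : LocalDvd (hζ.toInteger - 1) 2 (C - 1)) (hY : LocalDvd (hζ.toInteger - 1) p (Y - 1))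
    (hσC : σ C = C ^ n * Y) :
    LocalDvd (hζ.toInteger - 1) p (C - 1) ∨ ∃ k, 2 ≤ k ∧ k < p ∧
      LocalDvd (hζ.toInteger - 1) k (C - 1) ∧ ¬ LocalDvd (hζ.toInteger - 1) (k + 1) (C - 1) ∧
      (u : ZMod p) ^ k = n := by
  classical
  have hl := hζ.zeta_sub_one_prime'
  have hp : p.Prime := Fact.out
  by_contra! hcon
  obtain ⟨hpC, hcon⟩ := hcon
  have hC0 : LocalDvd (hζ.toInteger - 1) 0 C := by
    have := (hC.mono (Nat.zero_le 2)).add hl (one hl)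
    rwa [sub_add_cancel] at this
  have hall : ∀ k, 2 ≤ k → k ≤ p → LocalDvd (hζ.toInteger - 1) k (C - 1) := by
    intro k hk
    induction k, hk using Nat.le_induction with
    | base => exact fun _ => hC
    | succ k hk ih =>
      intro hkp
      have hkC := ih (by omega)
      by_contra hnot
      apply hcon k hk hkp hkC hnot
      by_contra hne
      apply hnot
      -- Modulo `π ^ (k + 1)`, `σ C - 1` is both `u ^ k * (C - 1)` and `n * (C - 1)`; if `u ^ k ≠ n`
      -- the valuation of `C - 1` must rise.
      have h1 := map_sub_pow_mul hζ hσ hkC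
      rw [map_sub, map_one, hσC] at h1
      have h2 := pow_sub_one_sub_mul hl (by omega) hkC n
      have h3 := (pow hl hC0 n).mul_left hl (hY.mono hkp)
      have hndvd : ¬ (p : ℤ) ∣ ((u : ℤ) ^ k - n) := by
        rw [← ZMod.intCast_zmod_eq_zero_iff_dvd]
        push_cast
        rwa [sub_eq_zero]
      refine of_intCast_mul hl hp hζ.toInteger_sub_one_dvd_prime' hndvd hkC ?_
      have h4 := (h2.add hl h3).sub hl h1
      convert h4 using 1
      push_cast
      ring
  exact hpC (hall p hp.two_le le_rfl)

end Cyclotomic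

end LocalDvd

/-! ### Galois action on numbers, classes and units -/

section Cyclotomic

variable {p : ℕ} [Fact p.Prime] {K : Type*} [Field K] [NumberField K]
  [IsCyclotomicExtension {p} ℚ K] {ζ : K} (hζ : IsPrimitiveRoot ζ p)

include hζ in
theorem algHom_ext_of_apply_zeta {A : Type*} [Ring A] [Algebra ℚ A] {f g : K →ₐ[ℚ] A}
    (h : f ζ = g ζ) : f = g :=
  (hζ.powerBasis ℚ).algHom_ext ((IsPrimitiveRoot.powerBasis_gen ℚ hζ).symm ▸ h)

include hζ in
theorem algEquiv_ext_of_apply_zeta {f g : K ≃ₐ[ℚ] K} (h : f ζ = g ζ) : f = g :=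
  AlgEquiv.ext fun x => DFunLike.congr_fun
    (algHom_ext_of_apply_zeta hζ (f := (f : K →ₐ[ℚ] K)) (g := (g : K →ₐ[ℚ] K)) h) x

theorem pow_apply_zeta {K : Type*} [Field K] [CharZero K] {ζ : K} {σ : K ≃ₐ[ℚ] K} {u : ℕ}
    (hσ : σ ζ = ζ ^ u) (i : ℕ) : (σ ^ i) ζ = ζ ^ u ^ i := by
  induction i with
  | zero => simp
  | succ i ih => rw [pow_succ, AlgEquiv.mul_apply, hσ, map_pow, ih, ← pow_mul, pow_succ]

theorem pow_eq_pow_iff_zmod {p : ℕ} [Fact p.Prime] {K : Type*} [Field K] {ζ : K}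
    (hζ : IsPrimitiveRoot ζ p) (a b : ℕ) : ζ ^ a = ζ ^ b ↔ (a : ZMod p) = b := by
  have hp : p.Prime := Fact.out
  rw [(isOfFinOrder_iff_pow_eq_one.mpr ⟨p, hp.pos, hζ.pow_eq_one⟩).pow_eq_pow_iff_modEq,
    ZMod.natCast_eq_natCast_iff, ← hζ.eq_orderOf]

include hζ in
theorem orderOf_eq_of_apply_zeta {σ : K ≃ₐ[ℚ] K} {u : ℕ} (hσ : σ ζ = ζ ^ u)
    (hu : IsPrimitiveRoot (u : ZMod p) (p - 1)) : orderOf σ = p - 1 := by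
  have hiff : ∀ i, σ ^ i = 1 ↔ (u : ZMod p) ^ i = 1 := by
    intro i
    have h1 : σ ^ i = 1 ↔ ζ ^ u ^ i = ζ ^ 1 := by
      rw [← pow_apply_zeta hσ, pow_one]
      exact ⟨fun h => by rw [h]; rfl, fun h => algEquiv_ext_of_apply_zeta hζ h⟩
    rw [h1, pow_eq_pow_iff_zmod hζ]
    push_cast
    rfl
  rw [hu.eq_orderOf]
  exact orderOf_eq_orderOf_iff.mpr hiff

-- A primitive root satisfies `u ^ ((p - 1) / 2) = -1`.
include hζ in
theorem conj_eq_pow (hp2 : p ≠ 2) {σ : K ≃ₐ[ℚ] K} {u : ℕ} (hσ : σ ζ = ζ ^ u)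
    (hu : IsPrimitiveRoot (u : ZMod p) (p - 1)) :
    CycSing.conj p K = σ ^ ((p - 1) / 2) := by
  have hp : p.Prime := Fact.out
  apply algEquiv_ext_of_apply_zeta hζ
  rw [CycSing.conj_apply p K ζ hζ.pow_eq_one, pow_apply_zeta hσ]
  refine inv_eq_of_mul_eq_one_right ?_
  have hodd := hp.odd_of_ne_two hp2
  have h2 : p - 1 = (p - 1) / 2 * 2 := by
    obtain ⟨k, hk⟩ := hodd; omega
  have hlt : 2 ≤ p := hp.two_le
  have hprim : IsPrimitiveRoot ((u : ZMod p) ^ ((p - 1) / 2)) 2 :=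
    hu.pow (by omega) h2
  have hneg : (u : ZMod p) ^ ((p - 1) / 2) = -1 := hprim.eq_neg_one_of_two_right
  rw [← pow_succ', hζ.pow_eq_one_iff_dvd, ← ZMod.natCast_eq_zero_iff]
  push_cast
  rw [hneg]
  ring

theorem ideal_map_ringEquiv_mem_nonZeroDivisors {A : Type*} [CommRing A] [IsDomain A] (e : A ≃+* A)
    (I : (Ideal A)⁰) : (I : Ideal A).map e ∈ (Ideal A)⁰ := by
  rw [mem_nonZeroDivisors_iff_ne_zero, Ne, Ideal.zero_eq_bot,
    Ideal.map_eq_bot_iff_of_injective e.injective]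
  exact nonZeroDivisors.coe_ne_zero I

theorem galClass_mul {K : Type*} [Field K] [NumberField K] (σ τ : K ≃ₐ[ℚ] K)
    (c : ClassGroup (𝓞 K)) :
    CycSing.galClass (σ * τ) c = CycSing.galClass σ (CycSing.galClass τ c) := by
  obtain ⟨I, rfl⟩ := ClassGroup.mk0_surjective c
  rw [CycSing.galClass_mk0 τ I ⟨_, ideal_map_ringEquiv_mem_nonZeroDivisors _ I⟩ rfl,
    CycSing.galClass_mk0 σ _ ⟨_, ideal_map_ringEquiv_mem_nonZeroDivisors _ _⟩ rfl]
  refine CycSing.galClass_mk0 (σ * τ) I _ ?_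
  exact Ideal.map_map (RingOfIntegers.mapRingEquiv τ.toRingEquiv : 𝓞 K →+* 𝓞 K)
    (RingOfIntegers.mapRingEquiv σ.toRingEquiv : 𝓞 K →+* 𝓞 K)

theorem galClass_one {K : Type*} [Field K] [NumberField K] (c : ClassGroup (𝓞 K)) :
    CycSing.galClass (1 : K ≃ₐ[ℚ] K) c = c := by
  obtain ⟨I, rfl⟩ := ClassGroup.mk0_surjective c
  exact CycSing.galClass_mk0 1 I I (Ideal.map_id (I : Ideal (𝓞 K))).symm

theorem galClass_pow {K : Type*} [Field K] [NumberField K] {σ : K ≃ₐ[ℚ] K}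
    {c : ClassGroup (𝓞 K)} {n : ℕ} (h : CycSing.galClass σ c = c ^ n) (i : ℕ) :
    CycSing.galClass (σ ^ i) c = c ^ n ^ i := by
  induction i with
  | zero => simpa using galClass_one c
  | succ i ih => rw [pow_succ, galClass_mul, h, map_pow, ih, ← pow_mul, ← pow_succ]

include hζ in
theorem map_conj_eq_star (φ : K →+* ℂ) (x : K) :
    φ (CycSing.conj p K x) = (starRingEnd ℂ) (φ x) := by
  have hp : p.Prime := Fact.out
  have h : (φ.comp (CycSing.conj p K : K →+* K)).toRatAlgHom =
      ((starRingEnd ℂ).comp φ).toRatAlgHom := by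
    apply algHom_ext_of_apply_zeta hζ
    change φ (CycSing.conj p K ζ) = (starRingEnd ℂ) (φ ζ)
    rw [CycSing.conj_apply p K ζ hζ.pow_eq_one, map_inv₀]
    refine Complex.inv_eq_conj (Complex.norm_eq_one_of_pow_eq_one (n := p) ?_ hp.ne_zero)
    rw [← map_pow, hζ.pow_eq_one, map_one]
  exact DFunLike.congr_fun h x

include hζ in
/-- The quotient of a unit by its complex conjugate is a root of unity. -/
theorem exists_unit_div_conj_eq (hp2 : p ≠ 2) (η : (𝓞 K)ˣ) :
    ∃ r : ℕ, (algebraMap (𝓞 K) K η) / CycSing.conj p K (algebraMap (𝓞 K) K η) = ζ ^ r ∨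
      (algebraMap (𝓞 K) K η) / CycSing.conj p K (algebraMap (𝓞 K) K η) = -ζ ^ r := by
  have hp : p.Prime := Fact.out
  set f := RingOfIntegers.mapRingEquiv (CycSing.conj p K).toRingEquiv
  let η' : (𝓞 K)ˣ := η * (Units.map (f : 𝓞 K →* 𝓞 K) η)⁻¹
  have hη' : (algebraMap (𝓞 K) K η') =
      (algebraMap (𝓞 K) K η) / CycSing.conj p K (algebraMap (𝓞 K) K η) := by
    have h1 : (η' : 𝓞 K) * f η = η := by
      have : η' * (Units.map (f : 𝓞 K →* 𝓞 K) η) = η := inv_mul_cancel_right _ _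
      exact congrArg Units.val this
    have h0 : CycSing.conj p K (algebraMap (𝓞 K) K η) ≠ 0 := by simp
    rw [eq_div_iff h0]
    exact (map_mul (algebraMap (𝓞 K) K) _ _).symm.trans (congrArg (algebraMap (𝓞 K) K) h1)
  -- Kronecker's theorem: conjugation commutes with every complex embedding, so `η / conj η` has all
  -- absolute values `1`.
  obtain ⟨n, hn, h1⟩ := Embeddings.pow_eq_one_of_norm_eq_one K ℂ
    (RingOfIntegers.isIntegral_coe (η' : 𝓞 K)) (fun φ => by
      change ‖φ (algebraMap (𝓞 K) K η')‖ = 1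
      rw [hη', map_div₀, norm_div, map_conj_eq_star hζ, Complex.norm_conj, div_self]
      simp)
  obtain ⟨r, -, hr⟩ := hζ.exists_pow_or_neg_mul_pow_of_isOfFinOrder (hp.odd_of_ne_two hp2)
    (isOfFinOrder_iff_pow_eq_one.mpr ⟨n, hn, h1⟩)
  refine ⟨r, ?_⟩
  rw [← hη']
  exact hr

include hζ in
/-- There is no singular primary number `c` whose `p`-th root generates an abelian extension of
`ℚ`. -/
theorem not_exists_primary_of_reflection {σ : K ≃ₐ[ℚ] K} {u : ℕ} (hσ : σ ζ = ζ ^ u)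
    (hu : IsPrimitiveRoot (u : ZMod p) (p - 1)) {n : ℕ} (hnu : (n : ZMod p) = u)
    (c d : 𝓞 K) (a : Ideal (𝓞 K)) (ha : Ideal.span {c} = a ^ p)
    (hc : ∀ b : K, b ^ p ≠ algebraMap (𝓞 K) K c) (hcl : ¬ hζ.toInteger - 1 ∣ c)
    (hcd : (hζ.toInteger - 1) ^ p ∣ c - d ^ p) (y : K)
    (hy : σ (algebraMap (𝓞 K) K c) = algebraMap (𝓞 K) K c ^ n * y ^ p) : False := by
  have hp : p.Prime := Fact.out
  have hgal : IsGalois ℚ K := IsCyclotomicExtension.isGalois {p} ℚ K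
  have hK : Module.finrank ℚ K = p - 1 := by
    rw [IsCyclotomicExtension.Rat.finrank p K, Nat.totient_prime hp]
  have hl := hζ.zeta_sub_one_prime'
  have hσn : σ ζ = ζ ^ n := by rw [hσ, pow_eq_pow_iff_zmod hζ, hnu]
  obtain ⟨L, _, _, _, α, hα, hadj, Q, hQ, hram⟩ := exists_not_isUnramifiedAt_kummer hK hζ σ
    (orderOf_eq_of_apply_zeta hζ hσ hu) n hσn _ y hc hy
  obtain ⟨w, hw⟩ := IsCyclotomicExtension.Rat.associated_zeta_sub_one_pow_prime p hζ
  obtain ⟨e, he⟩ := hcd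
  refine hram (isUnramifiedAt_of_isPrimary Q α hadj c d e _ w hα hl.ne_zero hw w.isUnit ?_ he hcl
    a ha)
  exact Ideal.IsPrime.isMaximal ((Ideal.span_singleton_prime hl.ne_zero).mpr hl)
    (by simpa using hl.ne_zero)

end Cyclotomic

/-! ### The relation between `σ C` and `C` -/

section Cyclotomic

variable {p : ℕ} [Fact p.Prime] {K : Type*} [Field K] [NumberField K]
  [IsCyclotomicExtension {p} ℚ K] {ζ : K} (hζ : IsPrimitiveRoot ζ p)

/-- If `b ^ p = (B)` and the class of `b` is inverted by complex conjugation, but is nontrivial, then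
`B / conj B` is not a `p`-th power. -/
theorem div_conj_not_pow (hp2 : p ≠ 2) {b : (Ideal (𝓞 K))⁰}
    (hb_minus : ClassGroup.mk0 b ∈ CycSing.minusPart p K) (hb_ne : ClassGroup.mk0 b ≠ 1)
    {B : 𝓞 K} (hBb : Ideal.span {B} = (b : Ideal (𝓞 K)) ^ p) (hB0 : B ≠ 0) :
    ¬ ∃ x : K, x ^ p = (B : K) / CycSing.conj p K (B : K) := by
  have hp : p.Prime := Fact.out
  rintro ⟨x, hx⟩
  set f := RingOfIntegers.mapRingEquiv (CycSing.conj p K).toRingEquiv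
  let b' : (Ideal (𝓞 K))⁰ := ⟨_, ideal_map_ringEquiv_mem_nonZeroDivisors f b⟩
  have hb' : CycSing.galClass (CycSing.conj p K) (ClassGroup.mk0 b) = ClassGroup.mk0 b' :=
    CycSing.galClass_mk0 _ b b' rfl
  have hBb' : Ideal.span {f B} = (b' : Ideal (𝓞 K)) ^ p := by
    have := congrArg (Ideal.map f) hBb
    rwa [Ideal.map_span, Set.image_singleton, Ideal.map_pow] at this
  obtain ⟨s, t, ht, rfl⟩ := IsFractionRing.div_surjective (A := 𝓞 K) x
  have ht0 : t ≠ 0 := nonZeroDivisors.ne_zero ht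
  have htK : algebraMap (𝓞 K) K t ≠ 0 := by simpa using ht0
  have hcB0 : CycSing.conj p K (B : K) ≠ 0 := by simpa using hB0
  have heq : s ^ p * f B = t ^ p * B := by
    apply FaithfulSMul.algebraMap_injective (𝓞 K) K
    rw [div_pow, div_eq_div_iff (pow_ne_zero _ htK) hcB0] at hx
    rw [map_mul, map_mul, map_pow, map_pow, mul_comm _ (algebraMap (𝓞 K) K B)]
    exact hx
  have hs0 : s ≠ 0 := by
    rintro rfl
    rw [zero_pow hp.ne_zero, zero_mul] at heq
    exact mul_ne_zero (pow_ne_zero _ ht0) hB0 heq.symm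
  have hideal : (Ideal.span {s} * (b' : Ideal (𝓞 K))) ^ p =
      (Ideal.span {t} * (b : Ideal (𝓞 K))) ^ p := by
    rw [mul_pow, mul_pow, ← hBb, ← hBb', Ideal.span_singleton_pow, Ideal.span_singleton_pow,
      Ideal.span_singleton_mul_span_singleton, Ideal.span_singleton_mul_span_singleton, heq]
  have hideal' : Ideal.span {s} * (b' : Ideal (𝓞 K)) = Ideal.span {t} * (b : Ideal (𝓞 K)) := by
    apply le_antisymm
    · exact Ideal.dvd_iff_le.mp ((UniqueFactorizationMonoid.pow_dvd_pow_iff_dvd hp.ne_zero).mp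
        (dvd_of_eq hideal.symm))
    · exact Ideal.dvd_iff_le.mp ((UniqueFactorizationMonoid.pow_dvd_pow_iff_dvd hp.ne_zero).mp
        (dvd_of_eq hideal))
  have hcl : ClassGroup.mk0 b' = ClassGroup.mk0 b :=
    ClassGroup.mk0_eq_mk0_iff.mpr ⟨s, t, hs0, ht0, hideal'⟩
  obtain ⟨h1, h2⟩ := hb_minus
  rw [hb', hcl] at h2
  have h3 : ClassGroup.mk0 b ^ 2 = 1 := by
    rw [sq]; nth_rewrite 1 [h2]; exact inv_mul_cancel _
  have h4 : ClassGroup.mk0 b ^ Nat.gcd p 2 = 1 := pow_gcd_eq_one.mpr ⟨h1, h3⟩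
  rw [(Nat.coprime_primes hp Nat.prime_two).mpr hp2, pow_one] at h4
  exact hb_ne h4

include hζ in
/-- The relation in the class group gives a relation between numbers. -/
theorem exists_map_div_conj_eq (hp2 : p ≠ 2) {b : (Ideal (𝓞 K))⁰} {σ : K ≃ₐ[ℚ] K} {n : ℕ}
    (hb_ann : CycSing.galClass σ (ClassGroup.mk0 b) = ClassGroup.mk0 b ^ n)
    {B : 𝓞 K} (hBb : Ideal.span {B} = (b : Ideal (𝓞 K)) ^ p) (hB0 : B ≠ 0)
    (hcomm : Commute σ (CycSing.conj p K)) :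
    ∃ (r : ℕ) (y : K), σ ((B : K) / CycSing.conj p K (B : K)) =
      ζ ^ r * ((B : K) / CycSing.conj p K (B : K)) ^ n * y ^ p := by
  have hp : p.Prime := Fact.out
  set f := RingOfIntegers.mapRingEquiv σ.toRingEquiv
  set cj := CycSing.conj p K
  let b' : (Ideal (𝓞 K))⁰ := ⟨_, ideal_map_ringEquiv_mem_nonZeroDivisors f b⟩
  rw [CycSing.galClass_mk0 _ b b' rfl, ← map_pow] at hb_ann
  obtain ⟨x, y, hx0, hy0, hxy⟩ := ClassGroup.mk0_eq_mk0_iff.mp hb_ann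
  have hBb' : Ideal.span {f B} = (b' : Ideal (𝓞 K)) ^ p := by
    have := congrArg (Ideal.map f) hBb
    rwa [Ideal.map_span, Set.image_singleton, Ideal.map_pow] at this
  have hassoc : Ideal.span {y ^ p * B ^ n} = Ideal.span {x ^ p * f B} := by
    have := congrArg (· ^ p) hxy
    simp only [mul_pow] at this
    rw [← hBb', SubmonoidClass.coe_pow, ← pow_mul, mul_comm n, pow_mul, ← hBb] at this
    simp only [Ideal.span_singleton_pow, Ideal.span_singleton_mul_span_singleton] at this
    exact this.symm
  obtain ⟨η, hη⟩ := Ideal.span_singleton_eq_span_singleton.mp hassoc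
  set xK := algebraMap (𝓞 K) K x
  set yK := algebraMap (𝓞 K) K y
  set ηK := algebraMap (𝓞 K) K η
  have hxK : xK ≠ 0 := by simpa [xK] using hx0
  have hyK : yK ≠ 0 := by simpa [yK] using hy0
  have hηK : ηK ≠ 0 := by simp [ηK]
  have hBK : (B : K) ≠ 0 := by simpa using hB0
  have hcjB : cj (B : K) ≠ 0 := by simpa using hB0
  have hσB : σ (B : K) = ηK * (B : K) ^ n * (yK / xK) ^ p := by
    have h := congrArg (algebraMap (𝓞 K) K) hη
    simp only [map_mul, map_pow] at h
    have h2 : algebraMap (𝓞 K) K (f B) = σ (B : K) := rfl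
    rw [h2] at h
    rw [div_pow, ← mul_div_assoc, eq_div_iff (pow_ne_zero _ hxK), mul_comm, ← h]
    simp only [yK, ηK]
    ring
  have hσcB : σ (cj (B : K)) = cj ηK * cj (B : K) ^ n * (cj (yK / xK)) ^ p := by
    have h : σ (cj (B : K)) = cj (σ (B : K)) := DFunLike.congr_fun hcomm.eq (B : K)
    rw [h, hσB, map_mul, map_mul, map_pow, map_pow]
  have hcη : cj ηK ≠ 0 := by simpa using hηK
  have hcz : cj (yK / xK) ≠ 0 := by simpa using ⟨hyK, hxK⟩
  have key : σ ((B : K) / cj (B : K)) =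
      (ηK / cj ηK) * ((B : K) / cj (B : K)) ^ n * ((yK / xK) / cj (yK / xK)) ^ p := by
    rw [map_div₀, hσB, hσcB, div_pow (B : K), div_pow (yK / xK)]
    generalize yK / xK = q at hcz ⊢
    field_simp
  obtain ⟨r, hr | hr⟩ := exists_unit_div_conj_eq hζ hp2 η
  · exact ⟨r, _, key.trans (by rw [hr])⟩
  -- As `p` is odd, the sign is a `p`-th power and is absorbed into `y`.
  · refine ⟨r, -((yK / xK) / cj (yK / xK)), key.trans ?_⟩
    rw [hr, (hp.odd_of_ne_two hp2).neg_pow]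
    ring

theorem not_dvd_of_localDvd_sub {c : ℤ} (hc : ¬ (p : ℤ) ∣ c) {A : 𝓞 K}
    (h : LocalDvd (hζ.toInteger - 1) 2 ((A : K) - c)) : ¬ hζ.toInteger - 1 ∣ A := by
  have hl := hζ.zeta_sub_one_prime'
  intro hd
  apply hc
  rw [← LocalDvd.one_intCast_iff hζ]
  have := (LocalDvd.of_dvd (k := 1) (a := A) hl (by rwa [pow_one])).sub hl (h.mono one_le_two)
  rwa [sub_sub_cancel] at this

theorem localDvd_div_sub_one {c : ℤ} (hc : ¬ (p : ℤ) ∣ c) {A A' : 𝓞 K}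
    (h : LocalDvd (hζ.toInteger - 1) 2 ((A : K) - c))
    (h' : LocalDvd (hζ.toInteger - 1) 2 ((A' : K) - c)) :
    LocalDvd (hζ.toInteger - 1) 2 ((A : K) / A' - 1) := by
  have hl := hζ.zeta_sub_one_prime'
  have hnd := not_dvd_of_localDvd_sub hζ hc h'
  have hA' : (A' : K) ≠ 0 := by
    intro h0
    have : A' = 0 := by simpa using h0
    exact hnd (this ▸ dvd_zero _)
  have h1 := (LocalDvd.inv_coe hnd).mul_left hl (h.sub hl h')
  convert h1 using 1
  rw [sub_sub_sub_cancel_right, mul_sub]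
  have : (algebraMap (𝓞 K) K A')⁻¹ * (A' : K) = 1 := inv_mul_cancel₀ hA'
  rw [this, div_eq_mul_inv, mul_comm]

/-- A root of unity occurring in the relation between `σ C` and `C` is trivial when
`C ≡ 1 mod (ζ - 1) ^ 2`. -/
theorem map_eq_pow_mul_pow (σ : K ≃ₐ[ℚ] K) {n r : ℕ} {C y : K} (hC0 : C ≠ 0)
    (hC : LocalDvd (hζ.toInteger - 1) 2 (C - 1)) (hC' : LocalDvd (hζ.toInteger - 1) 2 (C⁻¹ - 1))
    (h : σ C = ζ ^ r * C ^ n * y ^ p) :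
    σ C = C ^ n * y ^ p ∧ LocalDvd (hζ.toInteger - 1) p (y ^ p - 1) := by
  have hl := hζ.zeta_sub_one_prime'
  have hp : p.Prime := Fact.out
  have hζ1 : ζ ^ r * ζ ^ ((p - 1) * r) = 1 := by
    rw [← pow_add, hζ.pow_eq_one_iff_dvd]
    refine ⟨r, ?_⟩
    nth_rewrite 1 [← one_mul r]
    rw [← add_mul, Nat.add_sub_cancel' hp.one_le]
  have hζ0 : ∀ i : ℕ, LocalDvd (hζ.toInteger - 1) 0 (ζ ^ i) := fun i =>
    LocalDvd.pow hl (LocalDvd.coe hl hζ.toInteger) i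
  have hy : y ^ p = ζ ^ ((p - 1) * r) * (σ C * C⁻¹ ^ n) := by
    have hCn : C ^ n * C⁻¹ ^ n = 1 := by rw [← mul_pow, mul_inv_cancel₀ hC0, one_pow]
    rw [h]
    linear_combination (-(y ^ p)) * hCn - (C ^ n * C⁻¹ ^ n * y ^ p) * hζ1
  have hinv : LocalDvd (hζ.toInteger - 1) 2 (C⁻¹ ^ n - 1) := by
    have h1 := (LocalDvd.pow_sub_one_sub_mul hl one_le_two hC' n).mono (Nat.le_succ 2)
    have := h1.add hl ((LocalDvd.natCast hl n).mul_left hl hC')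
    rwa [sub_add_cancel] at this
  have hinv0 : LocalDvd (hζ.toInteger - 1) 0 (C⁻¹ ^ n) := by
    have := (hinv.mono (Nat.zero_le 2)).add hl (LocalDvd.one hl)
    rwa [sub_add_cancel] at this
  have hσC := hC.map σ (LocalDvd.associated_map hζ σ)
  rw [map_sub, map_one] at hσC
  have hprod : LocalDvd (hζ.toInteger - 1) 2 (σ C * C⁻¹ ^ n - 1) := by
    have := (hinv0.mul_left hl hσC).add hl hinv
    convert this using 1
    ring
  have hyζ : LocalDvd (hζ.toInteger - 1) 2 (y ^ p - ζ ^ ((p - 1) * r)) := by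
    have := (hζ0 ((p - 1) * r)).mul_left hl hprod
    rw [hy]
    convert this using 1
    ring
  have hy0 : LocalDvd (hζ.toInteger - 1) 0 y := by
    refine LocalDvd.of_pow hp.ne_zero (n := p) ?_
    have := (hyζ.mono (Nat.zero_le 2)).add hl (hζ0 ((p - 1) * r))
    rwa [sub_add_cancel] at this
  obtain ⟨h1, h2⟩ := LocalDvd.eq_one_of_pow_sub hζ hy0 hyζ
  rw [h1, mul_one] at hζ1
  rw [hζ1, one_mul] at h
  exact ⟨h, h2⟩

/-- If `C = B / A` satisfies `C ≡ 1 mod (ζ - 1) ^ p`, where `(B)` and `(A)` are `p`-th powers of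
ideals, and `σ C = C ^ n * y ^ p` with `σ ζ = ζ ^ n`, then `C` is a `p`-th power. -/
theorem exists_pow_eq_of_primary {σ : K ≃ₐ[ℚ] K} {u : ℕ} (hσ : σ ζ = ζ ^ u)
    (hu : IsPrimitiveRoot (u : ZMod p) (p - 1)) {n : ℕ} (hnu : (n : ZMod p) = u)
    {B A : 𝓞 K} {b a : Ideal (𝓞 K)} (hb : Ideal.span {B} = b ^ p) (ha : Ideal.span {A} = a ^ p)
    (hB : ¬ hζ.toInteger - 1 ∣ B) (hA : ¬ hζ.toInteger - 1 ∣ A)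
    (hC : LocalDvd (hζ.toInteger - 1) p ((B : K) / A - 1)) {y : K}
    (hy : σ ((B : K) / A) = ((B : K) / A) ^ n * y ^ p) : ∃ x : K, x ^ p = (B : K) / A := by
  by_contra! hnp
  have hl := hζ.zeta_sub_one_prime'
  have hp : p.Prime := Fact.out
  have hA0 : (A : K) ≠ 0 := by
    intro h0
    have : A = 0 := by simpa using h0
    exact hA (this ▸ dvd_zero _)
  have hσA0 : σ (A : K) ≠ 0 := by simpa using hA0
  have hp1 : p - 1 + 1 = p := Nat.sub_add_cancel hp.one_le
  -- Multiplying `C` by `A ^ p` gives an algebraic integer in the same class modulo `p`-th powers.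
  have hc : algebraMap (𝓞 K) K (B * A ^ (p - 1)) = (B : K) / A * (A : K) ^ p := by
    nth_rewrite 2 [← hp1]
    rw [map_mul, map_pow, pow_succ]
    field_simp
  refine not_exists_primary_of_reflection hζ hσ hu hnu (B * A ^ (p - 1)) A (b * a ^ (p - 1)) ?_ ?_
    ?_ ?_ (y * σ (A : K) / (A : K) ^ n) ?_
  · rw [← Ideal.span_singleton_mul_span_singleton, ← Ideal.span_singleton_pow, hb, ha, mul_pow,
      ← pow_mul, ← pow_mul, mul_comm p]
  · intro x hx
    rw [hc] at hx
    apply hnp (x / A)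
    rw [div_pow, hx, mul_div_cancel_right₀ _ (pow_ne_zero _ hA0)]
  · intro hd
    rcases hl.dvd_or_dvd hd with hd | hd
    · exact hB hd
    · exact hA (hl.dvd_of_dvd_pow hd)
  · apply LocalDvd.dvd hl
    rw [map_sub, hc, map_pow]
    have := (LocalDvd.coe hl (A ^ p)).mul_left hl hC
    convert this using 1
    rw [map_pow]
    ring
  · rw [hc, map_mul, map_pow, hy]
    simp only [div_pow, mul_pow]
    field_simp
    ring

end Cyclotomic

/-! ### The main theorem -/

theorem lemmal108171 {p : ℕ} [Fact p.Prime] (hp : p ≠ 2)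
    {K : Type*} [Field K] [NumberField K] [IsCyclotomicExtension {p} ℚ K]
    {ζ : K} (hζ : IsPrimitiveRoot ζ p)
    (u : ℕ) (hu : IsPrimitiveRoot (u : ZMod p) (p - 1))
    (σ : K ≃ₐ[ℚ] K) (hσ : σ ζ = ζ ^ u)
    (μ : (ZMod p)ˣ)
    (b : (Ideal (𝓞 K))⁰)
    (hb_minus : ClassGroup.mk0 b ∈ CycSing.minusPart p K)
    (hb_ne : ClassGroup.mk0 b ≠ 1)
    (hb_ann : CycSing.galClass σ (ClassGroup.mk0 b) = ClassGroup.mk0 b ^ (μ : ZMod p).val)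
    (B : 𝓞 K) (hBb : Ideal.span {B} = (b : Ideal (𝓞 K)) ^ p)
    (hB_sing : CycSing.IsSingular p (B : K))
    (hB_semi : CycSing.IsSemiPrimary p (CycSing.primeAbove hζ) (B : K)) :
    CycSing.IsSingular p ((B : K) / CycSing.conj p K (B : K)) ∧
    ∃ m : ℕ, 1 ≤ m ∧ m ≤ (p - 3) / 2 ∧
      (μ : ZMod p) = (CycSing.powRes p u (2 * m + 1) : ZMod p) ∧
      (¬ CycSing.IsSingularPrimary p (CycSing.primeAbove hζ)
          ((B : K) / CycSing.conj p K (B : K)) →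
        CycSing.ExactlyDivides (CycSing.primeAbove hζ) (2 * m + 1)
          ((B : K) / CycSing.conj p K (B : K) - 1)) := by
  have hprime : p.Prime := Fact.out
  have hl := hζ.zeta_sub_one_prime'
  have hodd : p % 2 = 1 := Nat.odd_iff.mp (hprime.odd_of_ne_two hp)
  have hp3 : 3 ≤ p := by have := hprime.two_le; omega
  obtain ⟨c, hc, hBc⟩ := hB_semi
  rw [CycSing.primeAbove, localDvd_iff_congMod] at hBc
  set cj := CycSing.conj p K with hcj
  set f := RingOfIntegers.mapRingEquiv cj.toRingEquiv
  have hfB : ((f B : 𝓞 K) : K) = cj (B : K) := rfl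
  have hBc' : LocalDvd (hζ.toInteger - 1) 2 ((f B : 𝓞 K) - (c : K)) := by
    have := hBc.map cj (LocalDvd.associated_map hζ cj)
    rwa [map_sub, map_intCast] at this
  have hBl := not_dvd_of_localDvd_sub hζ hc hBc
  have hfBl := not_dvd_of_localDvd_sub hζ hc hBc'
  have hB0 : B ≠ 0 := by rintro rfl; exact hBl (dvd_zero _)
  have hBK : (B : K) ≠ 0 := by simpa using hB0
  have hcBK : cj (B : K) ≠ 0 := by simpa using hB0
  have hfBb : Ideal.span {f B} = ((b : Ideal (𝓞 K)).map f) ^ p := by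
    have := congrArg (Ideal.map f) hBb
    rwa [Ideal.map_span, Set.image_singleton, Ideal.map_pow] at this
  have hnp := div_conj_not_pow hp hb_minus hb_ne hBb hB0
  have hsing : CycSing.IsSingular p ((B : K) / cj (B : K)) := by
    refine ⟨hnp, (b : Ideal (𝓞 K)) * (((b : Ideal (𝓞 K)).map f : Ideal (𝓞 K)) :
      FractionalIdeal (𝓞 K)⁰ K)⁻¹, ?_⟩
    rw [mul_pow, inv_pow, ← FractionalIdeal.coeIdeal_pow, ← FractionalIdeal.coeIdeal_pow, ← hBb,
      ← hfBb, FractionalIdeal.coeIdeal_span_singleton, FractionalIdeal.coeIdeal_span_singleton,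
      FractionalIdeal.spanSingleton_inv, FractionalIdeal.spanSingleton_mul_spanSingleton,
      ← div_eq_mul_inv]
    rfl
  refine ⟨hsing, ?_⟩
  have hC : LocalDvd (hζ.toInteger - 1) 2 ((B : K) / cj (B : K) - 1) :=
    localDvd_div_sub_one hζ hc hBc hBc'
  have hC' : LocalDvd (hζ.toInteger - 1) 2 (((B : K) / cj (B : K))⁻¹ - 1) := by
    rw [inv_div]
    exact localDvd_div_sub_one hζ hc hBc' hBc
  set n := (μ : ZMod p).val with hn
  have hnμ : (n : ZMod p) = μ := ZMod.natCast_zmod_val _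
  have hconj := conj_eq_pow hζ hp hσ hu
  have hcomm : Commute σ cj := by
    rw [hcj, hconj]
    exact (Commute.refl σ).pow_right _
  obtain ⟨r, y, hy⟩ := exists_map_div_conj_eq hζ hp hb_ann hBb hB0 hcomm
  obtain ⟨hσC, hyp⟩ := map_eq_pow_mul_pow hζ σ (div_ne_zero hBK hcBK) hC hC' hy
  have hu_half : (u : ZMod p) ^ ((p - 1) / 2) = -1 :=
    (hu.pow (by omega) (by omega : p - 1 = (p - 1) / 2 * 2)).eq_neg_one_of_two_right
  -- Conjugation acts on the class, of exact order `p`, both by inversion and by `μ ^ ((p - 1) /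
  -- 2)`.
  have hμ_half : (μ : ZMod p) ^ ((p - 1) / 2) = -1 := by
    have h1 := galClass_pow hb_ann ((p - 1) / 2)
    rw [← hconj, hb_minus.2] at h1
    have h2 : ClassGroup.mk0 b ^ (n ^ ((p - 1) / 2) + 1) = 1 := by
      rw [pow_succ, ← h1, inv_mul_cancel]
    have h3 := orderOf_dvd_of_pow_eq_one h2
    rw [orderOf_eq_prime hb_minus.1 hb_ne, ← ZMod.natCast_eq_zero_iff] at h3
    push_cast at h3
    rw [hnμ] at h3
    exact eq_neg_of_add_eq_zero_left h3
  have hne : NeZero (p - 1) := ⟨by omega⟩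
  obtain ⟨e, helt, he⟩ := hu.eq_pow_of_pow_eq_one (ZMod.pow_card_sub_one_eq_one μ.ne_zero)
  have heodd : e % 2 = 1 := by
    by_contra hcon
    have heven : Even e := Nat.even_iff.mpr (by omega)
    rw [← he, ← pow_mul, mul_comm, pow_mul, hu_half, heven.neg_one_pow] at hμ_half
    have : (2 : ℕ) < p := by omega
    have : Fact (2 < p) := ⟨this⟩
    exact ZMod.neg_one_ne_one hμ_half.symm
  have hpow : ∀ m, 2 * m + 1 = e → (μ : ZMod p) = (CycSing.powRes p u (2 * m + 1) : ZMod p) := by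
    intro m hm
    rw [hm, CycSing.powRes, ZMod.natCast_mod, Nat.cast_pow, he]
  have hem : 2 * ((e - 1) / 2) + 1 = e := by omega
  rcases LocalDvd.exists_exact hζ hσ hC hyp hσC with hprim | ⟨k, hk2, hkp, hkC, hkC', hk⟩
  -- Here `C` is primary, so the valuation claim is vacuous; reflection excludes `e = 1`, which
  -- gives `m ≥ 1`.
  · have he1 : e ≠ 1 := by
      rintro rfl
      rw [pow_one] at he
      exact hnp (exists_pow_eq_of_primary hζ hσ hu (hnμ.trans he.symm) hBb hfBb hBl hfBl hprim hσC)
    refine ⟨(e - 1) / 2, by omega, by omega, hpow _ hem, fun hnot => (hnot ⟨hsing, 1, ?_, ?_⟩).elim⟩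
    · intro h1
      exact (Nat.prime_iff_prime_int.mp hprime).not_dvd_one h1
    · rw [CycSing.primeAbove, localDvd_iff_congMod, Int.cast_one, one_pow]
      exact hprim
  · have hke : k = e := by
      rw [hnμ, ← he] at hk
      -- `k = p - 1` would give `e = 0`, which is not odd; below `p - 1` exponents of `u` are
      -- determined.
      have hkp1 : k ≠ p - 1 := by
        rintro rfl
        rw [hu.pow_eq_one, ← pow_zero (u : ZMod p)] at hk
        have := hu.pow_inj (by omega) helt hk
        omega
      exact hu.pow_inj (by omega) helt hk
    subst hke
    refine ⟨(k - 1) / 2, by omega, by omega, hpow _ hem, fun _ => ?_⟩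
    rw [hem, CycSing.ExactlyDivides, CycSing.primeAbove, localDvd_iff_congMod,
      localDvd_iff_congMod, sub_zero]
    exact ⟨hkC, hkC'⟩
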